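/- A partial linear space is a point-line geometry $(\mathcal P,\mathcal L,\mathrm I)$ in which every line has at least two points and any two distinct points are on at most one common line; distances between points are measured in its collinearity graph (distinct points being adjacent when they are on a common line). It has order $(s,t)$ if every line has exactly $s+1$ points and every point is on exactly $t+1$ lines. A near hexagon is a partial linear space whose collinearity graph is connected of diameter $3$ and such that for every point $x$ and every line $L$ there is a unique point of $L$ nearest to $x$. A geometry $(\mathcal P,\mathcal L,\mathrm I)$ is an isometrically embedded subgeometry of $(\mathcal P',\mathcal L',\mathrm I')$ if $\mathcal P\subseteq\mathcal P'$, $\mathcal L\subseteq\mathcal L'$, $\mathrm I=\mathrm I'\cap(\mathcal P\times\mathcal L)$, and the distances between points of $\mathcal P$ are the same in both geometries. Let $\mathrm H(2,1)$ be the generalized hexagon of order $(2,1)$ that is the point-line dual of the incidence graph of the Fano plane: its points are the flags of the Fano plane, its lines are the points and the lines of the Fano plane, and incidence is containment in the flag. Let $\mathrm H(2)$ be the split Cayley hexagon of order $(2,2)$: its points are the points of the quadric $X_0X_4+X_1X_5+X_2X_6=X_3^2$ of $\mathrm{PG}(6,2)$, its lines are the lines of that quadric whose Grassmann coordinates satisfy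 $p_{12}=p_{34}$, $p_{54}=p_{32}$, $p_{20}=p_{35}$, $p_{65}=p_{30}$, $p_{01}=p_{36}$, $p_{46}=p_{31}$, and incidence is containment. Let $\mathrm H(2)^D$ be its point-line dual. **Theorem.** The dual split Cayley hexagon $\mathrm H(2)^D$ is, up to isomorphism, the unique near hexagon of order $(2,2)$ that contains (an isomorphic copy of) $\mathrm H(2,1)$ as an isometrically embedded subgeometry. That is, $\mathrm H(2)^D$ is a near hexagon of order $(2,2)$ containing an isometrically embedded subgeometry isomorphic to $\mathrm H(2,1)$, and every near hexagon of order $(2,2)$ containing an isometrically embedded subgeometry isomorphic to $\mathrm H(2,1)$ is isomorphic to $\mathrm H(2)^D$. -/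

import Mathlib

/-! Point-line geometries are given by a type `P` of points, a type `L` of lines and an incidence
relation `I : P → L → Prop`. -/

namespace PointLine

variable {P L P' L' : Type*}

/-- A partial linear space: every line is incident with at least two points, and two distinct
points are incident with at most one common line. -/
structure IsPartialLinearSpace (I : P → L → Prop) : Prop where
  two_points : ∀ l : L, ∃ x y : P, x ≠ y ∧ I x l ∧ I y l
  line_unique : ∀ x y : P, x ≠ y → ∀ l m : L, I x l → I y l → I x m → I y m → l = m

/-- Order `(s, t)`: every line has exactly `s + 1` points, every point is on exactly `t + 1`
lines. -/
def HasOrder (I : P → L → Prop) (s t : ℕ) : Prop :=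
  (∀ l : L, {x : P | I x l}.ncard = s + 1) ∧ (∀ x : P, {l : L | I x l}.ncard = t + 1)

/-- The collinearity graph: distinct points are adjacent when they are on a common line. -/
def collinearityGraph (I : P → L → Prop) : SimpleGraph P where
  Adj x y := x ≠ y ∧ ∃ l : L, I x l ∧ I y l
  symm := ⟨fun _ _ h => ⟨h.1.symm, h.2.imp fun _ hl => ⟨hl.2, hl.1⟩⟩⟩
  loopless := ⟨fun _ h => h.1 rfl⟩

/-- The distance between two points, measured in the collinearity graph. -/
noncomputable def pdist (I : P → L → Prop) (x y : P) : ℕ :=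
  (collinearityGraph I).dist x y

/-- A near `2d`-gon: a partial linear space whose collinearity graph is connected of diameter `d`
and in which every line `l` has, for every point `x`, a unique point nearest to `x`. -/
structure IsNearPolygon (I : P → L → Prop) (d : ℕ) : Prop where
  isPartialLinearSpace : IsPartialLinearSpace I
  connected : (collinearityGraph I).Connected
  ediam_eq : (collinearityGraph I).ediam = d
  nearest : ∀ (x : P) (l : L), ∃! p : P, I p l ∧ ∀ q : P, I q l → pdist I x p ≤ pdist I x q

/-- A near hexagon is a near `2d`-gon with `d = 3`. -/
def IsNearHexagon (I : P → L → Prop) : Prop :=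
  IsNearPolygon I 3

/-- Two geometries are isomorphic: there are bijections between the points and between the lines
that preserve and reflect incidence. -/
def Isomorphic (I : P → L → Prop) (I' : P' → L' → Prop) : Prop :=
  ∃ (f : P ≃ P') (g : L ≃ L'), ∀ (x : P) (l : L), I x l ↔ I' (f x) (g l)

/-- `I` is isomorphic to an isometrically embedded subgeometry of `I'`: its points and its lines
are mapped injectively to points and lines of `I'`, incidence is the one induced from `I'`, and
distances between points agree. -/
def IsometricallyEmbeds (I : P → L → Prop) (I' : P' → L' → Prop) : Prop :=
  ∃ (f : P → P') (g : L → L'), Function.Injective f ∧ Function.Injective g ∧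
    (∀ (x : P) (l : L), I x l ↔ I' (f x) (g l)) ∧
    (∀ x y : P, pdist I x y = pdist I' (f x) (f y))

/-- The point-line dual of a geometry. -/
def dual (I : P → L → Prop) : L → P → Prop :=
  fun l x => I x l

/-! ### The generalized hexagon `H(2,1)` -/

/-- The points of the projective plane `PG(2,2)` over the field with two elements (the Fano plane);
over this field they are the nonzero vectors. Its lines are given by dual coordinates `a` in the
same set, the point `x` being on the line `a` when `a ⬝ᵥ x = 0`. -/
abbrev FanoVec : Type := {x : Fin 3 → ZMod 2 // x ≠ 0}

/-- The edges of the incidence graph of the Fano plane, i.e. its flags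
(pairs of a point and a line through it). -/
abbrev FanoFlag : Type := {e : FanoVec × FanoVec // e.2.1 ⬝ᵥ e.1.1 = 0}

/-- The incidence graph of the Fano plane as a geometry: its points are the vertices of the graph
(points `Sum.inl x` and lines `Sum.inr a` of the Fano plane), its lines are the edges. -/
def fanoGraphInc : FanoVec ⊕ FanoVec → FanoFlag → Prop
  | Sum.inl x, e => e.1.1 = x
  | Sum.inr a, e => e.1.2 = a

/-- `H(2,1)`, the point-line dual of the incidence graph of the Fano plane: the points are
the flags of the Fano plane, the lines are its points and its lines. -/
def H21 : FanoFlag → FanoVec ⊕ FanoVec → Prop :=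
  dual fanoGraphInc

/-! ### The split Cayley hexagon `H(2)` and its dual -/

/-- The quadratic form `X₀X₄ + X₁X₅ + X₂X₆ - X₃²`, which defines the parabolic quadric `Q(6,2)`. -/
def quadForm (x : Fin 7 → ZMod 2) : ZMod 2 :=
  x 0 * x 4 + x 1 * x 5 + x 2 * x 6 - x 3 ^ 2

/-- The Grassmann coordinate `p_{ij}` of the line through `x` and `y`. -/
def grassmann (x y : Fin 7 → ZMod 2) (i j : Fin 7) : ZMod 2 :=
  x i * y j - x j * y i

/-- The points of `H(2)`: all points of `Q(6,2)`. A point of `PG(6,2)` is a nonzero vector over the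
field with two elements. -/
abbrev CayleyPoint : Type := {x : Fin 7 → ZMod 2 // x ≠ 0 ∧ quadForm x = 0}

/-- `{x, y, x + y}` is a line of `PG(6,2)`, is contained in `Q(6,2)`, and its Grassmann coordinates
satisfy Tits' equations for the split Cayley hexagon. -/
def SpanHexagonLine (x y : Fin 7 → ZMod 2) : Prop :=
  x ≠ 0 ∧ y ≠ 0 ∧ x ≠ y ∧
  quadForm x = 0 ∧ quadForm y = 0 ∧ quadForm (x + y) = 0 ∧
  grassmann x y 1 2 = grassmann x y 3 4 ∧ grassmann x y 5 4 = grassmann x y 3 2 ∧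
  grassmann x y 2 0 = grassmann x y 3 5 ∧ grassmann x y 6 5 = grassmann x y 3 0 ∧
  grassmann x y 0 1 = grassmann x y 3 6 ∧ grassmann x y 4 6 = grassmann x y 3 1

/-- The lines of `H(2)`, as sets of three points of `Q(6,2)`. -/
abbrev CayleyLine : Type :=
  {l : Finset (Fin 7 → ZMod 2) // ∃ x y, SpanHexagonLine x y ∧ l = {x, y, x + y}}

/-- The split Cayley hexagon `H(2)`, with containment as incidence. -/
def H2 : CayleyPoint → CayleyLine → Prop :=
  fun x l => x.1 ∈ l.1

/-- The dual split Cayley hexagon `H(2)^D`. -/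
def H2D : CayleyLine → CayleyPoint → Prop :=
  dual H2

end PointLine

/-! Let S be a near hexagon of order (2,2) in which H = H(2,1) is isometrically embedded. A point z
of S gives a function on the 21 points of H, its distances from z. On every line of H one value is
smaller by one than the other two, and the triangle inequality holds. The functions with these
properties form a finite list, `valuations` (`partialValuations_eq`), and S is reconstructed from
it.

Each point of H is on two lines of H and one outer line. A point outside H that has a neighbour in H
is central (one such neighbour) or double (several). If no central point existed, outer lines would
get too many points (`exists_isCentral`). The three lines through a point must offer a step towards
every point of H; searching the list under this constraint shows that double points have no central
neighbours and that the functions at the neighbours of a central point are determined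
(`exists_neighbour_list`, `neighbours_of_isCentral`). Central neighbours therefore propagate from a
point of H to the opposite points, and so to all of H (`exists_isCentral_of_lt`). By connectedness
every point of S is in H or central; its function determines it, every admissible function occurs,
and collinearity can be read off from the functions (`valuation_injective`, `exists_valuation_eq`,
`adj_iff_onLine`). Since lines of size three are recovered from collinearity, any two such S are
isomorphic (`IsExtension.isomorphic`).

That H(2)^D is such an S is a finite verification in binary coordinates; H is embedded by sending
the flag (x, y) to the line {(x,0,0), (0,0,y), (x,0,y)}. -/

namespace PointLine

/-! ### Near polygons with three points per line -/

/-- One of the three numbers is smaller by one than each of the two others. -/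
def linePattern (a b c : ℕ) : Bool :=
  (Nat.beq b (a + 1) && Nat.beq c (a + 1)) || (Nat.beq a (b + 1) && Nat.beq c (b + 1)) ||
    (Nat.beq a (c + 1) && Nat.beq b (c + 1))

theorem linePattern_iff {a b c : ℕ} : linePattern a b c = true ↔
    (b = a + 1 ∧ c = a + 1) ∨ (a = b + 1 ∧ c = b + 1) ∨ (a = c + 1 ∧ b = c + 1) := by
  simp [linePattern, or_assoc]

section NearPolygon

variable {P L : Type*} {I : P → L → Prop} {d : ℕ}

theorem HasOrder.exists_third {t : ℕ} (hO : HasOrder I 2 t) {l : L} {x y : P} (hxy : x ≠ y)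
    (hx : I x l) (hy : I y l) :
    ∃ z, z ≠ x ∧ z ≠ y ∧ ∀ p, I p l ↔ p = x ∨ p = y ∨ p = z := by
  obtain ⟨a, b, c, hab, hac, hbc, h⟩ := Set.ncard_eq_three.1 (hO.1 l)
  have hp : ∀ p, I p l ↔ p = a ∨ p = b ∨ p = c := fun p => by
    simpa using Set.ext_iff.1 h p
  have hx' := (hp x).1 hx
  have hy' := (hp y).1 hy
  rcases hx' with rfl | rfl | rfl <;> rcases hy' with rfl | rfl | rfl <;>
    first
    | exact absurd rfl hxy
    | exact ⟨c, hac.symm, hbc.symm, fun p => by rw [hp]⟩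
    | exact ⟨c, hbc.symm, hac.symm, fun p => by rw [hp]; tauto⟩
    | exact ⟨b, hab.symm, hbc, fun p => by rw [hp]; tauto⟩
    | exact ⟨b, hbc, hab.symm, fun p => by rw [hp]; tauto⟩
    | exact ⟨a, hab, hac, fun p => by rw [hp]; tauto⟩
    | exact ⟨a, hac, hab, fun p => by rw [hp]; tauto⟩

theorem pdist_comm (x y : P) : pdist I x y = pdist I y x :=
  SimpleGraph.dist_comm

theorem pdist_eq_one_iff {x y : P} : pdist I x y = 1 ↔ (collinearityGraph I).Adj x y :=
  SimpleGraph.dist_eq_one_iff_adj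

namespace IsNearPolygon

theorem pdist_eq_zero_iff (hI : IsNearPolygon I d) {x y : P} : pdist I x y = 0 ↔ x = y :=
  hI.connected.dist_eq_zero_iff

theorem pdist_triangle (hI : IsNearPolygon I d) (x y z : P) :
    pdist I x z ≤ pdist I x y + pdist I y z :=
  hI.connected.dist_triangle

theorem pdist_le (hI : IsNearPolygon I d) (x y : P) : pdist I x y ≤ d := by
  have h := SimpleGraph.edist_le_ediam (G := collinearityGraph I) (u := x) (v := y)
  rw [hI.ediam_eq, ← (hI.connected x y).coe_dist_eq_edist] at h
  exact_mod_cast h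

theorem exists_adj_pdist_eq (hI : IsNearPolygon I d) {x y : P} (h : pdist I x y ≠ 0) :
    ∃ w, (collinearityGraph I).Adj x w ∧ pdist I w y + 1 = pdist I x y := by
  obtain ⟨p, hp⟩ := hI.connected.exists_walk_length_eq_dist x y
  cases p with
  | nil => exact absurd (hI.pdist_eq_zero_iff.2 rfl) h
  | cons hw q =>
    refine ⟨_, hw, ?_⟩
    have h1 : pdist I _ y ≤ q.length := SimpleGraph.dist_le q
    have h2 := hI.pdist_triangle x _ y |>.trans_eq (by rw [pdist_eq_one_iff.2 hw])
    simp only [SimpleGraph.Walk.length_cons] at hp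
    change _ = pdist I x y at hp
    omega

/-- Distances to collinear points differ by at most one, and the nearest point of the line is
strictly nearer than the other two. -/
theorem linePattern_pdist (hI : IsNearPolygon I d) {l : L} {x y z : P} (hxy : x ≠ y)
    (hxz : z ≠ x) (hyz : z ≠ y) (hl : ∀ p, I p l ↔ p = x ∨ p = y ∨ p = z) (p : P) :
    linePattern (pdist I p x) (pdist I p y) (pdist I p z) = true := by
  have hx : I x l := (hl x).2 (by simp)
  have hy : I y l := (hl y).2 (by simp)
  have hz : I z l := (hl z).2 (by simp)
  have key : ∀ a b, I a l → I b l → a ≠ b → pdist I p b ≤ pdist I p a + 1 := fun a b ha hb hab =>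
    (hI.pdist_triangle p a b).trans_eq (by rw [pdist_eq_one_iff.2 ⟨hab, l, ha, hb⟩])
  have h1 := key x y hx hy hxy
  have h2 := key y x hy hx hxy.symm
  have h3 := key x z hx hz hxz.symm
  have h4 := key z x hz hx hxz
  have h5 := key y z hy hz hyz.symm
  have h6 := key z y hz hy hyz
  obtain ⟨q, ⟨hq, hmin⟩, huniq⟩ := hI.nearest p l
  have lt : ∀ a, I a l → a ≠ q → pdist I p q < pdist I p a := fun a ha haq => by
    refine lt_of_le_of_ne (hmin a ha) fun heq => haq (huniq a ⟨ha, fun b hb => ?_⟩)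
    rw [← heq]
    exact hmin b hb
  rw [linePattern_iff]
  rcases (hl q).1 hq with rfl | rfl | rfl
  · have := lt y hy hxy.symm
    have := lt z hz hxz
    omega
  · have := lt x hx hxy
    have := lt z hz hyz
    omega
  · have := lt x hx hxz.symm
    have := lt y hy hyz.symm
    omega

/-- If `z` were off the line, `x` and `y` would both be nearest to it. So mutually collinear points
lie on one line. -/
theorem incident_of_adj (hI : IsNearPolygon I d) {l : L} {x y z : P} (hxy : x ≠ y)
    (hx : I x l) (hy : I y l) (hxz : pdist I z x = 1) (hyz : pdist I z y = 1) : I z l := by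
  obtain ⟨q, ⟨hq, hmin⟩, huniq⟩ := hI.nearest z l
  rcases Nat.lt_or_ge (pdist I z q) 1 with h | h
  · rw [hI.pdist_eq_zero_iff.1 (Nat.lt_one_iff.1 h)]
    exact hq
  · exact absurd ((huniq x ⟨hx, fun b hb => by have := hmin b hb; omega⟩).trans
      (huniq y ⟨hy, fun b hb => by have := hmin b hb; omega⟩).symm) hxy

end IsNearPolygon

theorem IsNearPolygon.line_ext (hI : IsNearPolygon I d) {l m : L} (h : ∀ x, I x l ↔ I x m) :
    l = m := by
  obtain ⟨x, y, hxy, hx, hy⟩ := hI.isPartialLinearSpace.two_points l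
  exact hI.isPartialLinearSpace.line_unique x y hxy l m hx hy ((h x).1 hx) ((h y).1 hy)

/-- The images of two points of `l` span a line; by `incident_of_adj` it contains the image of the
third, and there is no room for more. -/
theorem exists_line_of_adj_iff {P' L' : Type*} {I' : P' → L' → Prop} {d' t t' : ℕ}
    (hI : IsNearPolygon I d) (hO : HasOrder I 2 t) (hI' : IsNearPolygon I' d')
    (hO' : HasOrder I' 2 t') (f : P ≃ P')
    (hf : ∀ x y, (collinearityGraph I).Adj x y ↔ (collinearityGraph I').Adj (f x) (f y)) (l : L) :
    ∃ l' : L', ∀ x, I x l ↔ I' (f x) l' := by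
  obtain ⟨x, y, hxy, hx, hy⟩ := hI.isPartialLinearSpace.two_points l
  obtain ⟨z, hzx, hzy, hl⟩ := hO.exists_third hxy hx hy
  have hz : I z l := (hl z).2 (by simp)
  obtain ⟨hxy', l', hx', hy'⟩ := (hf x y).1 ⟨hxy, l, hx, hy⟩
  have hz' : I' (f z) l' := hI'.incident_of_adj hxy' hx' hy'
    (pdist_eq_one_iff.2 ((hf z x).1 ⟨hzx, l, hz, hx⟩))
    (pdist_eq_one_iff.2 ((hf z y).1 ⟨hzy, l, hz, hy⟩))
  obtain ⟨w, -, -, hl'⟩ := hO'.exists_third hxy' hx' hy'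
  have hw : f z = w := by
    rcases (hl' _).1 hz' with h | h | h
    · exact absurd (f.injective h) hzx
    · exact absurd (f.injective h) hzy
    · exact h
  refine ⟨l', fun p => ?_⟩
  rw [hl, hl', ← hw]
  simp

/-- Near polygons with three points on every line are determined by their collinearity graphs. -/
theorem Isomorphic.of_adj_iff {P' L' : Type*} {I' : P' → L' → Prop} {d' t t' : ℕ}
    (hI : IsNearPolygon I d) (hO : HasOrder I 2 t) (hI' : IsNearPolygon I' d')
    (hO' : HasOrder I' 2 t') (f : P ≃ P')
    (hf : ∀ x y, (collinearityGraph I).Adj x y ↔ (collinearityGraph I').Adj (f x) (f y)) :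
    Isomorphic I I' := by
  choose g hg using exists_line_of_adj_iff hI hO hI' hO' f hf
  choose g' hg' using exists_line_of_adj_iff hI' hO' hI hO f.symm fun x y => by simp [hf]
  refine ⟨f, ⟨g, g', fun l => hI.line_ext fun x => ?_, fun l => hI'.line_ext fun x => ?_⟩,
    fun x l => hg l x⟩
  · rw [hg l, hg' (g l), Equiv.symm_apply_apply]
  · rw [hg' l, hg (g' l), Equiv.apply_symm_apply]

/-- A function that is `1`-Lipschitz on the edges and drops along some edge wherever it is not
zero is the distance of the graph. -/
theorem dist_eq_of_lipschitz_of_descent {V : Type*} {G : SimpleGraph V}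
    {D : V → V → ℕ} (h0 : ∀ x, D x x = 0) (hz : ∀ x y, D x y = 0 → x = y)
    (hlip : ∀ x y z, G.Adj y z → D x z ≤ D x y + 1)
    (hdesc : ∀ x y, D x y ≠ 0 → ∃ z, G.Adj y z ∧ D x z + 1 = D x y) (x y : V) :
    G.Reachable x y ∧ G.dist x y = D x y := by
  have hwalk : ∀ n y, D x y = n → ∃ p : G.Walk y x, p.length = n := by
    intro n
    induction n with
    | zero =>
      intro y hy
      obtain rfl := hz x y hy
      exact ⟨.nil, rfl⟩
    | succ n ih =>
      intro y hy
      obtain ⟨z, hyz, hD⟩ := hdesc x y (by omega)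
      obtain ⟨p, hp⟩ := ih z (by omega)
      exact ⟨.cons hyz p, by simp [hp]⟩
  have hle : ∀ {a b} (p : G.Walk a b), D x b ≤ D x a + p.length := by
    intro a b p
    induction p with
    | nil => simp
    | cons h p ih =>
      have := hlip x _ _ h
      simp only [SimpleGraph.Walk.length_cons]
      omega
  obtain ⟨p, hp⟩ := hwalk _ y rfl
  have hr : G.Reachable x y := ⟨p.reverse⟩
  obtain ⟨q, hq⟩ := hr.exists_walk_length_eq_dist
  have h1 := hle q
  have h2 := SimpleGraph.dist_le p.reverse
  simp only [SimpleGraph.Walk.length_reverse] at h2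
  rw [h0] at h1
  exact ⟨hr, by omega⟩

/-- A partial linear space with a function that behaves on its lines like the distance of a near
polygon is a near polygon. -/
theorem IsNearPolygon.of_linePattern (hne : Nonempty P) (D : P → P → ℕ)
    (huniq : ∀ x y : P, x ≠ y → ∀ l m : L, I x l → I y l → I x m → I y m → l = m)
    (h0 : ∀ x, D x x = 0) (hz : ∀ x y, D x y = 0 → x = y)
    (hline : ∀ l : L, ∃ a b c, a ≠ b ∧ c ≠ a ∧ c ≠ b ∧ (∀ p, I p l ↔ p = a ∨ p = b ∨ p = c) ∧
      ∀ x, linePattern (D x a) (D x b) (D x c) = true)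
    (hdesc : ∀ x y, D x y ≠ 0 → ∃ z, (collinearityGraph I).Adj y z ∧ D x z + 1 = D x y)
    (hle : ∀ x y, D x y ≤ d) (hd : ∃ x y, D x y = d) :
    IsNearPolygon I d ∧ ∀ x y, pdist I x y = D x y := by
  have hlip : ∀ x y z, (collinearityGraph I).Adj y z → D x z ≤ D x y + 1 := by
    rintro x y z ⟨-, l, hy, hz⟩
    obtain ⟨a, b, c, -, -, -, hl, hp⟩ := hline l
    have := linePattern_iff.1 (hp x)
    rcases (hl y).1 hy with rfl | rfl | rfl <;> rcases (hl z).1 hz with rfl | rfl | rfl <;> omega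
  have key := dist_eq_of_lipschitz_of_descent h0 hz hlip hdesc
  have hdist : ∀ x y, pdist I x y = D x y := fun x y => (key x y).2
  have hed : ∀ x y, (collinearityGraph I).edist x y = D x y := fun x y => by
    rw [← (key x y).1.coe_dist_eq_edist, (key x y).2]
  refine ⟨⟨⟨fun l => ?_, huniq⟩, ⟨fun x y => (key x y).1⟩, le_antisymm ?_ ?_, fun x l => ?_⟩, hdist⟩
  · obtain ⟨a, b, c, hab, -, -, hl, -⟩ := hline l
    exact ⟨a, b, hab, (hl a).2 (by simp), (hl b).2 (by simp)⟩
  · exact SimpleGraph.ediam_le_of_edist_le fun x y => by rw [hed]; exact_mod_cast hle x y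
  · obtain ⟨x, y, hxy⟩ := hd
    rw [← hxy, ← hed]
    exact SimpleGraph.edist_le_ediam
  · obtain ⟨a, b, c, hab, hca, hcb, hl, hp⟩ := hline l
    simp only [hdist, hl]
    rcases linePattern_iff.1 (hp x) with h | h | h
    · refine ⟨a, ⟨by simp, ?_⟩, ?_⟩
      · rintro q (rfl | rfl | rfl) <;> omega
      · rintro q ⟨rfl | rfl | rfl, hq⟩
        · rfl
        all_goals have := hq a (by simp); omega
    · refine ⟨b, ⟨by simp, ?_⟩, ?_⟩
      · rintro q (rfl | rfl | rfl) <;> omega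
      · rintro q ⟨rfl | rfl | rfl, hq⟩
        · have := hq b (by simp); omega
        · rfl
        · have := hq b (by simp); omega
    · refine ⟨c, ⟨by simp, ?_⟩, ?_⟩
      · rintro q (rfl | rfl | rfl) <;> omega
      · rintro q ⟨rfl | rfl | rfl, hq⟩
        · have := hq c (by simp); omega
        · have := hq c (by simp); omega
        · rfl

end NearPolygon

/-! ### Valuations of the hexagon `H(2,1)`

The points of `H(2,1)` are numbered by `0, …, 20`. A function `v` on these points with values in
`{0, 1, 2, 3}` is coded by the number whose binary digit at the place `21 * k + i` is `1` if and
only if `k < v i`. Comparisons of functions become bitwise operations on their codes. -/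

/-- The number whose binary digits are `f 0, …, f (n - 1)`. -/
def bitPack (f : ℕ → Bool) : ℕ → ℕ
  | 0 => 0
  | n + 1 => bitPack f n ||| bif f n then 1 <<< n else 0

def encode (v : ℕ → ℕ) : ℕ := bitPack (fun j => Nat.blt (j / 21) (v (j % 21))) 63

/-- The value at `i` of the function coded by `c`. -/
def digit (c i : ℕ) : ℕ := c >>> i % 2 + c >>> (21 + i) % 2 + c >>> (42 + i) % 2

/-- The flags of the Fano plane, whose points and lines are coded by `1, …, 7` in binary. -/
def flagCodes : List (ℕ × ℕ) :=
  [(1, 2), (1, 4), (1, 6), (2, 1), (2, 4), (2, 5), (3, 3), (3, 4), (3, 7), (4, 1), (4, 2), (4, 3),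
   (5, 2), (5, 5), (5, 7), (6, 1), (6, 6), (6, 7), (7, 3), (7, 5), (7, 6)]

/-- The codes of the distance functions from the flags in the list `flagCodes`, as digits in
base `2 ^ 63`. -/
def distTable : ℕ :=
  1957804195746380894742991519235109036112411379465466577808299420580077580576865726179001391225936948321068679769012830889311792044038820656183210160969556116631711620325914263074682699073672397689969691213753545184039448486880053928344470019528336638734151373169664477911179518274480872988940836037702883805124071810645552229743956218460612712627386923506948006400661212476443102900091974720684030

/-- The code of the distance function from the point `i` of `H(2,1)`. -/
def hrow (i : ℕ) : ℕ := distTable >>> (63 * i) % 9223372036854775808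

/-- The distance between the points `i` and `j` of `H(2,1)`. -/
def hdist (i j : ℕ) : ℕ := digit (hrow i) j

/-- The pairs of points that form a line of `H(2,1)` with `k` and have smaller numbers. -/
def closingPairs (k : ℕ) : List (ℕ × ℕ) :=
  (List.range k).flatMap fun a => bif Nat.beq (hdist k a) 1 then
    ((List.range a).filter fun b => Nat.beq (hdist k b) 1 && Nat.beq (hdist a b) 1).map
      fun b => (a, b) else []

/-- Whether the value `d` at `k` is compatible with the values of the function coded by `c` at the
points with smaller numbers, as far as lines and the triangle inequality are concerned. -/
def extensionOk (l : List (ℕ × ℕ)) (k c d : ℕ) : Bool :=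
  -- This says `hdist k i ≤ digit c i + d` for all `i`; where no value is chosen yet the digit is 3,
  -- the largest distance, and the inequality is void.
  Nat.beq (c ||| hrow k >>> (21 * d)) c &&
    l.all fun e => linePattern (digit c e.1) (digit c e.2) d

/-- The binary digits by which the code of a function changes if its value at `k` is changed from
`3` to `d`. -/
def dropMask (k d : ℕ) : ℕ :=
  (bif Nat.blt d 1 then 1 <<< k else 0) |||
    (bif Nat.blt d 2 then 1 <<< (21 + k) else 0) ||| (bif Nat.blt d 3 then 1 <<< (42 + k) else 0)

/-- The codes of the functions that have the value `3` at all points except possibly `0, …, k - 1`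
and satisfy the conditions `extensionOk` at these points. -/
def partialValuations : ℕ → List ℕ
  -- This is `2 ^ 63 - 1`, the code of the constant function 3.
  | 0 => [9223372036854775807]
  | k + 1 => (partialValuations k).flatMap fun c =>
      ([0, 1, 2, 3].filter (extensionOk (closingPairs k) k c)).map fun d => c ^^^ dropMask k d

/-- The codes of the functions on the points of `H(2,1)` that can be the distance function from a
point of a near hexagon in which `H(2,1)` is isometrically embedded. -/
def valuations : List ℕ :=
  [4180928138238230526, 4298690242054979581, 120930748438937595, 7470631754888380415,
   7784124494127299583, 6318202831524331519, 6738444970679599103, 7362193485784416255,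
   840979060688420863, 6748824361251110911, 7459759779651518463, 6642356434398871551,
   3579908567527849983, 6197907401075585023, 7902519922312347647, 6732885840575332335,
   7851185923415867391, 7410677583907389311, 6295192252109029375, 7879227867853225983,
   6264687401038249983, 6306627170957524991, 7455045078084485119, 789715430552895487,
   7795066841361022975, 3557179463156367359, 6691684941245186047, 4241550822057443327,
   3564251590661505023, 4192503798809231359, 783278339723886591, 68611243551686655,
   4277227775389073407, 4283103565259472895, 4248693249625030655, 98622207272419327,
   4288381219193749503, 825112008381693951, 3520517209996656639, 7027334978631368191,
   4392729272855298047, 4432417242424016895, 969148031611961343, 6985957958412664831,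
   5869909881863012351, 6498162090010738687, 530892042578952191, 444478614843416575,
   6582886066590580735, 973018854663911423, 7735174252432719871, 5832403340746555391,
   3902610960547839999, 493385501462495231, 4325104900053663743, 5874343110665830399,
   7022761017792790527, 7651013225940516863, 3989586737478238207, 6547631325824679935,
   542326961427447807, 7640000513181745151, 3996588427523915775, 6554633015870357503,
   4336610190800453631, 927384731715108863, 3892161174657040383, 6594320985439076351,
   7742738892566036479, 6929838876357820415, 4421334167380295679, 5826456976241983487,
   7746327696237395967, 961653760239599615, 6978463687040303103, 3958800411363639295,
   5776002526000168959, 6486727158411558911, 4000740181282914303, 537470970470858751,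
   7707202676756316159, 877492733747396607, 4385797951570575359, 5856113208833605623,
   879634573690929119, 4445079220208533503, 7752973146629603327, 3956438660353622015,
   4378932599859445759, 7040559911989673983, 535109219460841471, 7704840925746298879,
   6493372608803766271, 4007385631675121663, 6586540842972872703, 920660117525889023,
   7009527291545911295, 5888130988625625087, 3994367414035808255, 6552412002382249983,
   549113149341564927, 4414609553191075839, 5819732362052763647, 6932121642885709823,
   7740517879077928959, 3898947362571157503, 6601107173353193471, 486590514905219007,
   6924486427044478719, 7728379266143879167, 3904823152441556991, 6606982963223592959,
   4424988943762587647, 5830111752624275455, 979734679068344319, 524237244223979519,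
   7693968950509436927, 6500515036371353599, 4014528059242708991, 4390578628128145407,
   873266752216104959, 446831595563778047, 7760678524284829695, 966997386884808703,
   6983807313685512191, 5772338996742979583, 4439273799099088895, 7837969789359226879,
   6644515875221143551, 3582068008350121983, 3513669244338274303, 7904679363134619647,
   6299990520856838143, 729033916328443903, 6720232660012105727, 822766750020927487,
   6204570469392187391, 7872520845854244863, 7356858655234326527, 835644230138331135,
   3472503495188152319, 6262483979740381183, 3550472441157386239, 6684977919246204927,
   123230995498401791, 7452841656786616319, 787512009255026687, 6313430951061880831,
   7441828944027844607, 776499296496254975, 6320432641107558399, 3561977731904176127,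
   6696483209992994815, 116723467209932799, 7364423295367643135, 843208870271647743,
   7884589086688673791, 66337659672330239, 3466557680439525375, 6745178380963938303,
   810767225508855807, 7897185091762257919, 7404040927867568127, 6210587013729484799,
   3524189715743899647, 735615043244130303, 7473002301993517055, 102860274851119103,
   7849052870878953471, 6637584553936420863, 3575136687065399295]

def mem (c : ℕ) (l : List ℕ) : Bool := l.any (Nat.beq c)

def ones (c : ℕ) : List ℕ := (List.range 21).filter fun i => Nat.beq (digit c i) 1

/-- For the code of a point this means that the point belongs to H(2,1). -/
def hasZero (c : ℕ) : Bool := (List.range 21).any fun i => Nat.beq (digit c i) 0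

/-- The point is not in `H(2,1)` and is collinear with exactly one point of it. -/
def isCentral (c : ℕ) : Bool := !hasZero c && Nat.beq (ones c).length 1

/-- The point is not in `H(2,1)` and is collinear with at least two points of it. -/
def isDouble (c : ℕ) : Bool := !hasZero c && Nat.ble 2 (ones c).length

/-- These turn out to be exactly the codes that occur. -/
def regular (V : List ℕ) : List ℕ := V.filter fun c => hasZero c || isCentral c

/-- The code for the third point of a line, `v` and `w` being the codes for two points of it. -/
def third (v w : ℕ) : ℕ := v ^^^ w ||| v >>> 21 ||| w >>> 21

/-- Whether the functions coded by `v` and `w` differ by at most one. -/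
def compat (v w : ℕ) : Bool := Nat.beq (v ||| w >>> 21) v && Nat.beq (w ||| v >>> 21) w

/-- Whether `v` and `w` can belong to two points of a line, the code for the third point of which
is also in `V`. -/
def onLine (V : List ℕ) (v w : ℕ) : Bool := compat v w && mem (third v w) V

/-- Among the lines through a point coded by `v` that are determined by `ws` there is none that
contains a point nearer to `j`. -/
def uncovered (v : ℕ) (ws : List ℕ) (j : ℕ) : Bool :=
  !Nat.beq (digit v j) 0 && ws.all fun w => Nat.ble (digit v j + 1) (digit w j)

/-- The codes of the possible neighbours of a point coded by `v` that are nearer to `j`. -/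
def candidates (V : List ℕ) (v j : ℕ) : List ℕ :=
  V.filter fun w => compat v w && Nat.beq (digit v j) (digit w j + 1) && mem (third v w) V

/-- Whether the codes of the neighbours of a point coded by `v` necessarily satisfy `Q` if they
are in `V` and the point is on three lines. -/
def starCheck (V : List ℕ) (v : ℕ) (Q : List ℕ → Bool) : Bool :=
  (ones v).any fun y₁ => uncovered v [] y₁ && (candidates V v y₁).all fun w₁ =>
  (ones v ++ List.range 21).any fun y₂ => uncovered v [w₁] y₂ && (candidates V v y₂).all fun w₂ =>
  (List.range 21).any fun y₃ => uncovered v [w₁, w₂] y₃ && (candidates V v y₃).all fun w₃ =>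
  (List.range 21).any (uncovered v [w₁, w₂, w₃]) ||
    Q [w₁, third v w₁, w₂, third v w₂, w₃, third v w₃]

/-- Whether the points that are collinear with at least two points of `H(2,1)` have no central
neighbours. -/
def doubleCheck (V : List ℕ) : Bool := V.all fun v => !isDouble v ||
  starCheck V v fun l => l.all fun x => !isCentral x

/-- Whether the neighbours of a central point are determined by its code. -/
def centralCheck (V : List ℕ) : Bool := V.all fun v => !isCentral v ||
  starCheck (V.filter fun x => !isDouble x) v fun l => (l.all fun x => mem x (regular V)) &&
    (regular V).all fun x => !onLine (regular V) v x || mem x l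

/-- Whether `a` and `b` cannot both belong to points outside `H(2,1)` because there would be
two lines through a point of `H(2,1)` that are not lines of `H(2,1)`. -/
def conflict (a b : ℕ) : Bool := (List.range 21).any fun i =>
  Nat.beq (digit a i) 1 && Nat.beq (digit b i) 1 && !Nat.beq a b && !Nat.beq (third (hrow i) a) b

/-- A point outside H(2,1) with code `v` forces these codes to occur too, on the outer lines through
its neighbours in H(2,1). -/
def spread (v : ℕ) : List ℕ := v :: (ones v).map fun i => third (hrow i) v

/-- Whether it is impossible that each point of `H(2,1)` has a neighbour outside `H(2,1)` that is
collinear with at least two points of `H(2,1)`. -/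
def gridCheck (V : List ℕ) : Bool := V.all fun v => !(isDouble v && Nat.beq (digit v 0) 1) ||
  (List.range 21).any fun u => V.all fun w => !(isDouble w && Nat.beq (digit w u) 1) ||
  (spread v).any fun a => (spread w).any fun b => conflict a b

/-- Whether every point opposite to the point of `H(2,1)` next to a central point also has a central
neighbour. -/
def oppositeCheck (V : List ℕ) : Bool := V.all fun v => !isCentral v || (ones v).all fun i =>
  (List.range 21).all fun k => !Nat.beq (hdist i k) 3 || (regular V).any fun w =>
    isCentral w && Nat.beq (digit w k) 1 &&
      (onLine (regular V) v w || onLine (regular V) (third (hrow i) v) w)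

/-- Whether every point of `H(2,1)` has exactly two possible central neighbours, which are on a
line with it. -/
def pairCheck (V : List ℕ) : Bool := V.all fun v => !isCentral v || (ones v).all fun i =>
  !Nat.beq (third (hrow i) v) v && isCentral (third (hrow i) v) &&
  V.all fun w => !(isCentral w && Nat.beq (digit w i) 1) || Nat.beq w v ||
    Nat.beq w (third (hrow i) v)

def zeroCheck (V : List ℕ) : Bool := V.all fun v => (List.range 21).all fun i =>
  !Nat.beq (digit v i) 0 || Nat.beq v (hrow i)

/-! ### Results of the finite computations -/

theorem partialValuations_eq : partialValuations 21 = valuations := by decide +kernel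

theorem gridCheck_valuations : gridCheck valuations = true := by decide +kernel

theorem oppositeCheck_valuations : oppositeCheck valuations = true := by decide +kernel

theorem centralCheck_valuations : centralCheck valuations = true := by decide +kernel

theorem doubleCheck_valuations : doubleCheck valuations = true := by decide +kernel

theorem pairCheck_valuations : pairCheck valuations = true := by decide +kernel

theorem zeroCheck_valuations : zeroCheck valuations = true := by decide +kernel

/-! Elementary properties of these definitions. -/

theorem testBit_bitPack (f : ℕ → Bool) (n j : ℕ) :
    (bitPack f n).testBit j = (decide (j < n) && f j) := by
  induction n with
  | zero => simp [bitPack]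
  | succ n ih =>
    rw [bitPack, Nat.testBit_or, ih]
    have hb : (bif f n then 1 <<< n else 0).testBit j = (f n && decide (n = j)) := by
      cases f n <;> simp [Nat.shiftLeft_eq, Nat.testBit_two_pow]
    rw [hb]
    rcases lt_trichotomy j n with h | rfl | h
    · simp [h, h.ne', Nat.lt_succ_of_lt h]
    · simp
    · simp [h.ne, h.not_gt, Nat.not_lt.2 (Nat.succ_le_of_lt h)]

theorem testBit_encode (v : ℕ → ℕ) (j : ℕ) :
    (encode v).testBit j = true ↔ j < 63 ∧ j / 21 < v (j % 21) := by
  simp [encode, testBit_bitPack, Nat.blt]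

theorem encode_congr {v w : ℕ → ℕ} (h : ∀ i < 21, v i = w i) : encode v = encode w := by
  refine Nat.eq_of_testBit_eq fun j => Bool.eq_iff_iff.2 ?_
  rw [testBit_encode, testBit_encode, h _ (Nat.mod_lt _ (by norm_num))]

theorem digit_encode {v : ℕ → ℕ} {i : ℕ} (hv : v i < 4) (hi : i < 21) :
    digit (encode v) i = v i := by
  have key : ∀ k < 3, encode v >>> (21 * k + i) % 2 = if k < v i then 1 else 0 := by
    intro k hk
    have h := testBit_encode v (21 * k + i)
    rw [Nat.testBit_eq_decide_div_mod_eq, decide_eq_true_eq, Nat.mul_add_mod,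
      Nat.mod_eq_of_lt hi, Nat.mul_add_div (by norm_num), Nat.div_eq_of_lt hi, add_zero] at h
    rw [Nat.shiftRight_eq_div_pow]
    split_ifs with hlt
    · exact h.2 ⟨by omega, hlt⟩
    · have := Nat.mod_two_eq_zero_or_one (encode v / 2 ^ (21 * k + i))
      exact this.resolve_right fun h1 => hlt (h.1 h1).2
  have h0 := key 0 (by norm_num)
  have h1 := key 1 (by norm_num)
  have h2 := key 2 (by norm_num)
  norm_num at h0 h1 h2
  rw [digit, h0, h1, h2]
  split_ifs <;> omega

/-- Two equal values `m` force the third to be `m - 1`, which a shift by 21 places produces. Values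
`m` and `m + 1` force `m + 1`: the exclusive or supplies the digit at level `m`, the shifted larger
value the digits below it. -/
theorem encode_third {a b c : ℕ → ℕ} (ha : ∀ i < 21, a i < 4) (hb : ∀ i < 21, b i < 4)
    (h : ∀ i < 21, linePattern (a i) (b i) (c i) = true) :
    encode c = third (encode a) (encode b) := by
  refine Nat.eq_of_testBit_eq fun j => Bool.eq_iff_iff.2 ?_
  have hj : j % 21 < 21 := Nat.mod_lt _ (by norm_num)
  have h1 := linePattern_iff.1 (h _ hj)
  have h2 := ha _ hj
  have h3 := hb _ hj
  have h4 : (21 + j) / 21 = j / 21 + 1 := by omega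
  have h5 : (21 + j) % 21 = j % 21 := by omega
  have hx : ∀ p q : Bool, (p ^^ q) = true ↔ ¬ (p = true ↔ q = true) := by decide
  rw [third, Nat.testBit_or, Nat.testBit_or, Nat.testBit_xor, Nat.testBit_shiftRight,
    Nat.testBit_shiftRight, Bool.or_eq_true, Bool.or_eq_true, hx, testBit_encode, testBit_encode,
    testBit_encode, testBit_encode, testBit_encode, h4, h5]
  omega

/-- In this unary code pointwise comparison is inclusion of digit sets, and a shift by `21 * d`
subtracts `d`, truncated at 0. -/
theorem or_shiftRight_encode_eq_iff {v w : ℕ → ℕ} {d : ℕ} (hw : ∀ i < 21, w i < 4) :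
    encode v ||| encode w >>> (21 * d) = encode v ↔ ∀ i < 21, w i ≤ v i + d := by
  have hbit : ∀ j, (encode w >>> (21 * d)).testBit j = true ↔
      21 * d + j < 63 ∧ d + j / 21 < w (j % 21) := fun j => by
    rw [Nat.testBit_shiftRight, testBit_encode, Nat.mul_add_mod, Nat.mul_add_div (by norm_num)]
  constructor
  · intro h i hi
    -- The place `21 * v i + i` is the lowest one at which the digit of `v` at `i` is missing.
    by_contra! hlt
    have h1 := hw i hi
    have h2 := (hbit (21 * v i + i)).2
    rw [Nat.mul_add_mod, Nat.mod_eq_of_lt hi, Nat.mul_add_div (by norm_num),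
      Nat.div_eq_of_lt hi] at h2
    have h3 := congrArg (fun m => Nat.testBit m (21 * v i + i)) h
    simp only [Nat.testBit_or] at h3
    rw [h2 ⟨by omega, by omega⟩, Bool.or_true, eq_comm, testBit_encode, Nat.mul_add_mod,
      Nat.mod_eq_of_lt hi, Nat.mul_add_div (by norm_num), Nat.div_eq_of_lt hi] at h3
    omega
  · intro h
    refine Nat.eq_of_testBit_eq fun j => Bool.eq_iff_iff.2 ?_
    have := h (j % 21) (Nat.mod_lt _ (by norm_num))
    rw [Nat.testBit_or, Bool.or_eq_true, hbit, testBit_encode]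
    omega

theorem compat_encode_iff {v w : ℕ → ℕ} (hv : ∀ i < 21, v i < 4) (hw : ∀ i < 21, w i < 4) :
    compat (encode v) (encode w) = true ↔ ∀ i < 21, w i ≤ v i + 1 ∧ v i ≤ w i + 1 := by
  have h1 := or_shiftRight_encode_eq_iff (v := v) (d := 1) hw
  have h2 := or_shiftRight_encode_eq_iff (v := w) (d := 1) hv
  rw [mul_one] at h1 h2
  rw [compat, Bool.and_eq_true, Nat.beq_eq, Nat.beq_eq, h1, h2]
  exact ⟨fun h i hi => ⟨h.1 i hi, h.2 i hi⟩,
    fun h => ⟨fun i hi => (h i hi).1, fun i hi => (h i hi).2⟩⟩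

theorem mem_iff {c : ℕ} {l : List ℕ} : mem c l = true ↔ c ∈ l := by
  simp [mem]

theorem mem_ones {c i : ℕ} : i ∈ ones c ↔ i < 21 ∧ digit c i = 1 := by
  simp [ones]

theorem hasZero_iff {c : ℕ} : hasZero c = true ↔ ∃ i < 21, digit c i = 0 := by
  simp [hasZero]

theorem hrow_eq_encode {i : ℕ} (hi : i < 21) : hrow i = encode (hdist i) := by
  have : ∀ i < 21, hrow i = encode (hdist i) := by decide +kernel
  exact this i hi

theorem hdist_lt (i j : ℕ) : hdist i j < 4 := by
  rw [hdist, digit]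
  omega

theorem mem_closingPairs {k a b : ℕ} : (a, b) ∈ closingPairs k ↔
    a < k ∧ hdist k a = 1 ∧ b < a ∧ hdist k b = 1 ∧ hdist a b = 1 := by
  simp only [closingPairs, List.mem_flatMap, List.mem_range, cond_eq_ite]
  constructor
  · rintro ⟨x, hx, h⟩
    split_ifs at h with h1
    · simp at h h1
      obtain ⟨h2, rfl⟩ := h
      tauto
    · simp at h
  · rintro ⟨h1, h2, h3, h4, h5⟩
    exact ⟨a, h1, by simp [h2, h3, h4, h5]⟩

theorem encode_update_three {v : ℕ → ℕ} {k : ℕ} (hk : k < 21) (hv : v k < 4) :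
    encode (fun i => if i < k + 1 then v i else 3) =
      encode (fun i => if i < k then v i else 3) ^^^ dropMask k (v k) := by
  refine Nat.eq_of_testBit_eq fun j => Bool.eq_iff_iff.2 ?_
  have hx : ∀ p q : Bool, (p ^^ q) = true ↔ ¬ (p = true ↔ q = true) := by decide
  have hd : (dropMask k (v k)).testBit j = true ↔
      (v k < 1 ∧ j = k) ∨ (v k < 2 ∧ j = 21 + k) ∨ (v k < 3 ∧ j = 42 + k) := by
    have hb : ∀ (p : Bool) (n : ℕ), (bif p then 1 <<< n else 0).testBit j = true ↔
        p = true ∧ j = n := fun p n => by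
      cases p <;> simp [Nat.shiftLeft_eq, Nat.testBit_two_pow, eq_comm]
    rw [dropMask, Nat.testBit_or, Nat.testBit_or, Bool.or_eq_true, Bool.or_eq_true, hb, hb, hb,
      Nat.blt_eq, Nat.blt_eq, Nat.blt_eq, or_assoc]
  rw [Nat.testBit_xor, hx, hd, testBit_encode, testBit_encode]
  by_cases hjk : j % 21 = k
  · rw [hjk, if_pos (Nat.lt_succ_self k), if_neg (lt_irrefl k)]
    omega
  · have : (if j % 21 < k + 1 then v (j % 21) else 3) = if j % 21 < k then v (j % 21) else 3 := by
      congr 1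
      exact propext (by omega)
    rw [this]
    omega

/-- The enumeration assigns the values at `0, 1, …` in turn; the truncation of `v` survives every
stage. -/
theorem encode_mem_partialValuations {v : ℕ → ℕ} (hv : ∀ i < 21, v i < 4)
    (htri : ∀ i < 21, ∀ j < 21, hdist i j ≤ v j + v i)
    (hline : ∀ k < 21, ∀ e ∈ closingPairs k, linePattern (v e.1) (v e.2) (v k) = true) :
    ∀ k ≤ 21, encode (fun i => if i < k then v i else 3) ∈ partialValuations k := by
  intro k hk
  induction k with
  | zero =>
    have : encode (fun i => if i < 0 then v i else 3) = encode fun _ => 3 :=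
      encode_congr fun i _ => if_neg (Nat.not_lt_zero i)
    rw [this, partialValuations, List.mem_singleton]
    decide +kernel
  | succ k ih =>
    have hk' : k < 21 := hk
    have hdig : ∀ i < k, digit (encode fun i => if i < k then v i else 3) i = v i := fun i hi => by
      have h4 := hv i (by omega)
      rw [digit_encode (by rw [if_pos hi]; exact h4) (by omega), if_pos hi]
    rw [partialValuations, List.mem_flatMap]
    refine ⟨_, ih (by omega), List.mem_map.2 ⟨v k, List.mem_filter.2 ⟨?_, ?_⟩,
      (encode_update_three hk' (hv k hk')).symm⟩⟩
    · have := hv k hk'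
      simp only [List.mem_cons, List.not_mem_nil]
      omega
    · rw [extensionOk, Bool.and_eq_true, List.all_eq_true, Nat.beq_eq, hrow_eq_encode hk',
        or_shiftRight_encode_eq_iff fun i _ => hdist_lt k i]
      refine ⟨fun i hi => ?_, fun e he => ?_⟩
      · have := htri k hk' i hi
        have := hdist_lt k i
        split_ifs <;> omega
      · obtain ⟨h1, -, h2, -⟩ := mem_closingPairs.1 he
        rw [hdig _ h1, hdig _ (h2.trans h1)]
        exact hline k hk' e he

theorem encode_mem_valuations {v : ℕ → ℕ} (hv : ∀ i < 21, v i < 4)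
    (htri : ∀ i < 21, ∀ j < 21, hdist i j ≤ v j + v i)
    (hline : ∀ k < 21, ∀ e ∈ closingPairs k, linePattern (v e.1) (v e.2) (v k) = true) :
    encode v ∈ valuations := by
  have h := encode_mem_partialValuations hv htri hline 21 le_rfl
  rwa [partialValuations_eq, encode_congr (w := v) fun i hi => if_pos hi] at h

/-! ### Near hexagons of order `(2,2)` that contain `H(2,1)` -/

-- The condition `hdist a c = 2` keeps the two lines through `i` apart.
set_option synthInstance.maxSize 2000 in
set_option synthInstance.maxHeartbeats 400000 in
theorem exists_pencil_hdist : ∀ i < 21, ∃ a < 21, ∃ b < 21,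
    (hdist i a = 1 ∧ hdist i b = 1 ∧ hdist a b = 1) ∧ ∃ c < 21, ∃ d < 21,
    (hdist i c = 1 ∧ hdist i d = 1 ∧ hdist c d = 1 ∧ hdist a c = 2) ∧
    ∀ j < 21, hdist i j = 1 → j = a ∨ j = b ∨ j = c ∨ j = d := by
  decide +kernel

/-- A near hexagon of order `(2,2)` with points `φ 0, …, φ 20` that have the same mutual distances
as the points of `H(2,1)`. -/
structure IsExtension {P L : Type*} (I : P → L → Prop) (φ : ℕ → P) : Prop where
  near : IsNearPolygon I 3
  order : HasOrder I 2 2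
  dist_eq : ∀ i < 21, ∀ j < 21, pdist I (φ i) (φ j) = hdist i j

/-- The code of the function that gives the distances from `z` to the points of `H(2,1)`. -/
noncomputable def valuation {P L : Type*} (I : P → L → Prop) (φ : ℕ → P) (z : P) : ℕ :=
  encode fun i => pdist I z (φ i)

namespace IsExtension

variable {P L : Type*} {I : P → L → Prop} {φ : ℕ → P}

theorem pdist_lt (h : IsExtension I φ) (x y : P) : pdist I x y < 4 :=
  Nat.lt_succ_of_le (h.near.pdist_le x y)

theorem digit_valuation (h : IsExtension I φ) (z : P) {i : ℕ} (hi : i < 21) :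
    digit (valuation I φ z) i = pdist I z (φ i) :=
  digit_encode (h.pdist_lt _ _) hi

theorem valuation_hpoint (h : IsExtension I φ) {i : ℕ} (hi : i < 21) :
    valuation I φ (φ i) = hrow i :=
  (encode_congr fun j hj => h.dist_eq i hi j hj).trans (hrow_eq_encode hi).symm

theorem exists_third_point (h : IsExtension I φ) {z w : P} {l : L} (hzw : z ≠ w) (hz : I z l)
    (hw : I w l) : ∃ t, t ≠ z ∧ t ≠ w ∧ (∀ p, I p l ↔ p = z ∨ p = w ∨ p = t) ∧
      (∀ p, linePattern (pdist I p z) (pdist I p w) (pdist I p t) = true) ∧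
      valuation I φ t = third (valuation I φ z) (valuation I φ w) := by
  obtain ⟨t, htz, htw, hl⟩ := h.order.exists_third hzw hz hw
  have hp := h.near.linePattern_pdist hzw htz htw hl
  refine ⟨t, htz, htw, hl, hp, encode_third (fun i _ => h.pdist_lt _ _) (fun i _ => h.pdist_lt _ _)
    fun i _ => ?_⟩
  rw [pdist_comm z, pdist_comm w, pdist_comm t]
  exact hp (φ i)

/-- A closing pair and its point are mutually collinear, hence the three points of a line, to which
the near polygon axiom applies. -/
theorem valuation_mem (h : IsExtension I φ) (z : P) : valuation I φ z ∈ valuations := by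
  refine encode_mem_valuations (fun i _ => h.pdist_lt _ _) (fun i hi j hj => ?_)
    fun k hk e he => ?_
  · rw [← h.dist_eq i hi j hj, pdist_comm (φ i) (φ j), pdist_comm z (φ j)]
    exact h.near.pdist_triangle _ _ _
  · obtain ⟨a, b⟩ := e
    obtain ⟨ha, hka, hb, hkb, hab⟩ := mem_closingPairs.1 he
    rw [← h.dist_eq k hk a (by omega)] at hka
    rw [← h.dist_eq k hk b (by omega)] at hkb
    rw [← h.dist_eq a (by omega) b (by omega), pdist_eq_one_iff] at hab
    obtain ⟨hne, l, hla, hlb⟩ := hab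
    have hlk := h.near.incident_of_adj hne hla hlb hka hkb
    obtain ⟨t, -, -, hl, hp, -⟩ := h.exists_third_point hne hla hlb
    rcases (hl _).1 hlk with heq | heq | heq
    · rw [h.near.pdist_eq_zero_iff.2 heq] at hka; omega
    · rw [h.near.pdist_eq_zero_iff.2 heq] at hkb; omega
    · have := hp z
      rwa [← heq] at this

theorem compat_of_adj (h : IsExtension I φ) {z w : P} (hzw : (collinearityGraph I).Adj z w) :
    compat (valuation I φ z) (valuation I φ w) = true := by
  have h1 := pdist_eq_one_iff.2 hzw
  refine (compat_encode_iff (fun i _ => h.pdist_lt _ _) fun i _ => h.pdist_lt _ _).2 fun i _ => ?_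
  have h2 := h.near.pdist_triangle z w (φ i)
  have h3 := h.near.pdist_triangle w z (φ i)
  rw [pdist_comm w z] at h3
  omega

theorem onLine_of_adj (h : IsExtension I φ) {V : List ℕ} {z w : P}
    (hzw : (collinearityGraph I).Adj z w)
    (hV : ∀ x, (collinearityGraph I).Adj z x → valuation I φ x ∈ V) :
    onLine V (valuation I φ z) (valuation I φ w) = true := by
  rw [onLine, h.compat_of_adj hzw, Bool.true_and, mem_iff]
  obtain ⟨hne, l, hz, hw⟩ := hzw
  obtain ⟨t, htz, -, hl, -, ht⟩ := h.exists_third_point hne hz hw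
  rw [← ht]
  exact hV t ⟨htz.symm, l, hz, (hl t).2 (by simp)⟩

/-! ### The three lines through a point -/

theorem eq_of_lines (h : IsExtension I φ) {z : P} {l₁ l₂ l₃ l : L} (h₁₂ : l₁ ≠ l₂) (h₁₃ : l₁ ≠ l₃)
    (h₂₃ : l₂ ≠ l₃) (h₁ : I z l₁) (h₂ : I z l₂) (h₃ : I z l₃) (hl : I z l) :
    l = l₁ ∨ l = l₂ ∨ l = l₃ := by
  obtain ⟨a, b, c, hab, hac, hbc, hs⟩ := Set.ncard_eq_three.1 (h.order.2 z)
  have hp : ∀ m, I z m → m = a ∨ m = b ∨ m = c := fun m hm => by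
    simpa using (Set.ext_iff.1 hs m).1 hm
  have e₁ := hp _ h₁
  have e₂ := hp _ h₂
  have e₃ := hp _ h₃
  have e := hp _ hl
  grind

/-- Take the first step of a shortest path from `z` to `φ j`. If a point with code in `ws` on a line
through `z` is farther from `φ j` than `z`, so is the third point of that line; hence the step uses
another line. -/
theorem exists_candidate (h : IsExtension I φ) {V : List ℕ} {z : P} {ws : List ℕ} {j : ℕ}
    (hV : ∀ x, (collinearityGraph I).Adj z x → valuation I φ x ∈ V) (hj : j < 21)
    (hu : uncovered (valuation I φ z) ws j = true) :
    ∃ w l, z ≠ w ∧ I z l ∧ I w l ∧ valuation I φ w ∈ candidates V (valuation I φ z) j ∧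
      ∀ x, z ≠ x → valuation I φ x ∈ ws → ¬ I x l := by
  simp only [uncovered, Bool.and_eq_true, Bool.not_eq_true', List.all_eq_true, Nat.ble_eq] at hu
  rw [h.digit_valuation _ hj] at hu
  have hne : pdist I z (φ j) ≠ 0 := fun h0 => by simp [h0] at hu
  obtain ⟨w, hzw, hw⟩ := h.near.exists_adj_pdist_eq hne
  have hzw' := hzw
  obtain ⟨hzw₁, l, hzl, hwl⟩ := hzw'
  refine ⟨w, l, hzw₁, hzl, hwl, ?_, fun x hzx hx hxl => ?_⟩
  · have hl := h.onLine_of_adj hzw hV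
    rw [onLine, Bool.and_eq_true] at hl
    rw [candidates, List.mem_filter, h.digit_valuation _ hj, h.digit_valuation _ hj, hw, hl.1, hl.2]
    exact ⟨hV w hzw, by simp⟩
  · obtain ⟨t, -, -, hl, hp, -⟩ := h.exists_third_point hzx hzl hxl
    have := hu.2 _ hx
    have ht := linePattern_iff.1 (hp (φ j))
    rw [pdist_comm (φ j) z, pdist_comm (φ j) x, pdist_comm (φ j) t] at ht
    rw [h.digit_valuation _ hj] at this
    rcases (hl w).1 hwl with rfl | rfl | rfl
    · exact hzw₁ rfl
    · omega
    · omega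

/-- Steps towards `y`, `y'`, `y''` use three different lines, which are all the lines through `z`. A
further uncovered `j` would need a fourth; otherwise the six codes on these lines are those of all
neighbours. -/
theorem exists_neighbour_list (h : IsExtension I φ) {V : List ℕ} {z : P} {Q : List ℕ → Bool}
    (hV : ∀ x, (collinearityGraph I).Adj z x → valuation I φ x ∈ V)
    (hQ : starCheck V (valuation I φ z) Q = true) :
    ∃ N, Q N = true ∧ ∀ c, c ∈ N ↔ ∃ x, (collinearityGraph I).Adj z x ∧ valuation I φ x = c := by
  simp only [starCheck, List.any_eq_true, List.all_eq_true, Bool.and_eq_true, List.mem_range,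
    List.mem_append, Bool.or_eq_true] at hQ
  obtain ⟨y, hy, hu, hQ⟩ := hQ
  obtain ⟨w, l, hw, hzl, hwl, hc, -⟩ := h.exists_candidate hV (mem_ones.1 hy).1 hu
  obtain ⟨y', hy', hu', hQ⟩ := hQ _ hc
  obtain ⟨w', l', hw', hzl', hwl', hc', hn'⟩ := h.exists_candidate hV
    (hy'.elim (fun m => (mem_ones.1 m).1) id) hu'
  obtain ⟨y'', hy'', hu'', hQ⟩ := hQ _ hc'
  obtain ⟨w'', l'', hw'', hzl'', hwl'', hc'', hn''⟩ := h.exists_candidate hV hy'' hu''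
  have h₁₂ : l ≠ l' := fun e => hn' w hw (by simp) (e ▸ hwl)
  have h₁₃ : l ≠ l'' := fun e => hn'' w hw (by simp) (e ▸ hwl)
  have h₂₃ : l' ≠ l'' := fun e => hn'' w' hw' (by simp) (e ▸ hwl')
  have hall := fun m => h.eq_of_lines (l := m) h₁₂ h₁₃ h₂₃ hzl hzl' hzl''
  rcases hQ _ hc'' with ⟨j, hj, hu⟩ | hQ
  · obtain ⟨x, m, hx, hzm, hxm, -, hn⟩ := h.exists_candidate hV hj hu
    rcases hall m hzm with rfl | rfl | rfl
    · exact absurd hwl (hn w hw (by simp))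
    · exact absurd hwl' (hn w' hw' (by simp))
    · exact absurd hwl'' (hn w'' hw'' (by simp))
  · obtain ⟨t, htz, -, hl, -, ht⟩ := h.exists_third_point hw hzl hwl
    obtain ⟨t', htz', -, hl', -, ht'⟩ := h.exists_third_point hw' hzl' hwl'
    obtain ⟨t'', htz'', -, hl'', -, ht''⟩ := h.exists_third_point hw'' hzl'' hwl''
    refine ⟨_, hQ, fun c => ⟨fun hc => ?_, ?_⟩⟩
    · rw [← ht, ← ht', ← ht''] at hc
      simp only [List.mem_cons, List.not_mem_nil, or_false] at hc
      rcases hc with rfl | rfl | rfl | rfl | rfl | rfl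
      · exact ⟨w, ⟨hw, l, hzl, hwl⟩, rfl⟩
      · exact ⟨t, ⟨htz.symm, l, hzl, (hl t).2 (by simp)⟩, rfl⟩
      · exact ⟨w', ⟨hw', l', hzl', hwl'⟩, rfl⟩
      · exact ⟨t', ⟨htz'.symm, l', hzl', (hl' t').2 (by simp)⟩, rfl⟩
      · exact ⟨w'', ⟨hw'', l'', hzl'', hwl''⟩, rfl⟩
      · exact ⟨t'', ⟨htz''.symm, l'', hzl'', (hl'' t'').2 (by simp)⟩, rfl⟩
    · rintro ⟨x, ⟨hzx, m, hzm, hxm⟩, rfl⟩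
      rw [← ht, ← ht', ← ht'']
      rcases hall m hzm with rfl | rfl | rfl
      · rcases (hl x).1 hxm with rfl | rfl | rfl
        · exact absurd rfl hzx
        all_goals simp
      · rcases (hl' x).1 hxm with rfl | rfl | rfl
        · exact absurd rfl hzx
        all_goals simp
      · rcases (hl'' x).1 hxm with rfl | rfl | rfl
        · exact absurd rfl hzx
        all_goals simp

/-! ### Outer lines through points of H(2,1) -/

theorem hasZero_valuation_iff (h : IsExtension I φ) {z : P} :
    hasZero (valuation I φ z) = true ↔ ∃ i < 21, z = φ i := by
  rw [hasZero_iff]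
  refine exists_congr fun i => and_congr_right fun hi => ?_
  rw [h.digit_valuation _ hi, h.near.pdist_eq_zero_iff]

/-- The two lines of `H(2,1)` through the point `i`. -/
theorem exists_two_lines (h : IsExtension I φ) {i : ℕ} (hi : i < 21) :
    ∃ l₁ l₂, l₁ ≠ l₂ ∧ I (φ i) l₁ ∧ I (φ i) l₂ ∧
      (∀ x, I x l₁ ∨ I x l₂ → ∃ j < 21, x = φ j) ∧
      ∀ j < 21, hdist i j = 1 → I (φ j) l₁ ∨ I (φ j) l₂ := by
  obtain ⟨a, ha, b, hb, ⟨hia, hib, hab⟩, c, hc, d, hd, ⟨hic, hid, hcd, hac⟩, hall⟩ :=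
    exists_pencil_hdist i hi
  have hl : ∀ a < 21, ∀ b < 21, hdist i a = 1 → hdist i b = 1 → hdist a b = 1 →
      ∃ l, ∀ p, I p l ↔ p = φ a ∨ p = φ b ∨ p = φ i := by
    intro a ha b hb hia hib hab
    rw [← h.dist_eq i hi a ha] at hia
    rw [← h.dist_eq i hi b hb] at hib
    rw [← h.dist_eq a ha b hb, pdist_eq_one_iff] at hab
    obtain ⟨hne, l, hla, hlb⟩ := hab
    have hli := h.near.incident_of_adj hne hla hlb hia hib
    obtain ⟨t, -, -, hl, -⟩ := h.exists_third_point hne hla hlb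
    rcases (hl _).1 hli with heq | heq | heq
    · rw [h.near.pdist_eq_zero_iff.2 heq] at hia; omega
    · rw [h.near.pdist_eq_zero_iff.2 heq] at hib; omega
    · exact ⟨l, by simpa [heq] using hl⟩
  obtain ⟨l₁, hl₁⟩ := hl a ha b hb hia hib hab
  obtain ⟨l₂, hl₂⟩ := hl c hc d hd hic hid hcd
  refine ⟨l₁, l₂, ?_, (hl₁ _).2 (by simp), (hl₂ _).2 (by simp), ?_, fun j hj hij => ?_⟩
  · rintro rfl
    have hne : φ a ≠ φ c := fun e => by
      have := h.dist_eq a ha c hc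
      rw [h.near.pdist_eq_zero_iff.2 e] at this
      omega
    have := pdist_eq_one_iff.2 ⟨hne, l₁, (hl₁ (φ a)).2 (by simp), (hl₂ (φ c)).2 (by simp)⟩
    rw [h.dist_eq a ha c hc] at this
    omega
  · rintro x (hx | hx)
    · rcases (hl₁ x).1 hx with e | e | e
      exacts [⟨a, ha, e⟩, ⟨b, hb, e⟩, ⟨i, hi, e⟩]
    · rcases (hl₂ x).1 hx with e | e | e
      exacts [⟨c, hc, e⟩, ⟨d, hd, e⟩, ⟨i, hi, e⟩]
  · rcases hall j hj hij with rfl | rfl | rfl | rfl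
    · exact Or.inl ((hl₁ _).2 (by simp))
    · exact Or.inl ((hl₁ _).2 (by simp))
    · exact Or.inr ((hl₂ _).2 (by simp))
    · exact Or.inr ((hl₂ _).2 (by simp))

/-- The line through the point `i` of `H(2,1)` that is not a line of `H(2,1)`. -/
theorem exists_outer_line (h : IsExtension I φ) {i : ℕ} (hi : i < 21) :
    ∃ l, I (φ i) l ∧ (∀ x, I x l → x ≠ φ i → hasZero (valuation I φ x) = false) ∧
      ∀ x, pdist I x (φ i) = 1 → hasZero (valuation I φ x) = false → I x l := by
  obtain ⟨l₁, l₂, h₁₂, h₁, h₂, hsub, hnb⟩ := h.exists_two_lines hi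
  obtain ⟨l, hl, hne₁, hne₂⟩ : ∃ l, I (φ i) l ∧ l₁ ≠ l ∧ l₂ ≠ l := by
    by_contra! hcon
    have : {l | I (φ i) l} ⊆ {l₁, l₂} := fun l hl => by
      by_cases e : l₁ = l
      · simp [e]
      · simp [hcon l hl e]
    have := (Set.ncard_le_ncard this (by simp)).trans (Set.ncard_pair h₁₂).le
    rw [h.order.2] at this
    omega
  refine ⟨l, hl, fun x hx hxi => ?_, fun x hx h0 => ?_⟩
  · rw [Bool.eq_false_iff]
    intro h0
    obtain ⟨j, hj, rfl⟩ := h.hasZero_valuation_iff.1 h0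
    have hij := pdist_eq_one_iff.2 (show (collinearityGraph I).Adj (φ i) (φ j) from
      ⟨hxi.symm, l, hl, hx⟩)
    rw [h.dist_eq i hi j hj] at hij
    rcases hnb j hj hij with hj' | hj'
    · exact hne₁ (h.near.isPartialLinearSpace.line_unique _ _ hxi _ _ hj' h₁ hx hl)
    · exact hne₂ (h.near.isPartialLinearSpace.line_unique _ _ hxi _ _ hj' h₂ hx hl)
  · obtain ⟨-, m, hxm, him⟩ := pdist_eq_one_iff.1 hx
    rw [Bool.eq_false_iff, Ne, h.hasZero_valuation_iff] at h0
    rcases h.eq_of_lines h₁₂ hne₁ hne₂ h₁ h₂ hl him with rfl | rfl | rfl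
    · exact absurd (hsub x (Or.inl hxm)) h0
    · exact absurd (hsub x (Or.inr hxm)) h0
    · exact hxm

/-- Both points are on the outer line through `φ i`, which has only two points besides `φ i`. -/
theorem valuation_eq_or_third (h : IsExtension I φ) {i : ℕ} (hi : i < 21) {x y : P}
    (hx : pdist I x (φ i) = 1) (hx0 : hasZero (valuation I φ x) = false)
    (hy : pdist I y (φ i) = 1) (hy0 : hasZero (valuation I φ y) = false) :
    y = x ∨ valuation I φ y = third (hrow i) (valuation I φ x) := by
  obtain ⟨l, hl, -, hmem⟩ := h.exists_outer_line hi
  have hne : ∀ {z}, pdist I z (φ i) = 1 → z ≠ φ i := fun hz => (pdist_eq_one_iff.1 hz).1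
  obtain ⟨t, -, -, hl', -, ht⟩ := h.exists_third_point (hne hx).symm hl (hmem x hx hx0)
  rw [h.valuation_hpoint hi] at ht
  rcases (hl' y).1 (hmem y hy hy0) with e | e | e
  · exact absurd e (hne hy)
  · exact Or.inl e
  · exact Or.inr (e ▸ ht)

theorem exists_valuation_eq_third (h : IsExtension I φ) {i : ℕ} (hi : i < 21) {x : P}
    (hx : pdist I x (φ i) = 1) (hx0 : hasZero (valuation I φ x) = false) :
    ∃ t, pdist I t (φ i) = 1 ∧ hasZero (valuation I φ t) = false ∧
      valuation I φ t = third (hrow i) (valuation I φ x) := by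
  obtain ⟨l, hl, hout, hmem⟩ := h.exists_outer_line hi
  have hne : ∀ {z}, pdist I z (φ i) = 1 → z ≠ φ i := fun hz => (pdist_eq_one_iff.1 hz).1
  obtain ⟨t, hti, -, hl', -, ht⟩ := h.exists_third_point (hne hx).symm hl (hmem x hx hx0)
  rw [h.valuation_hpoint hi] at ht
  have htl : I t l := (hl' t).2 (by simp)
  exact ⟨t, pdist_eq_one_iff.2 ⟨hti, l, htl, hl⟩, hout t htl hti, ht⟩

theorem exists_outer_neighbour (h : IsExtension I φ) {i : ℕ} (hi : i < 21) :
    ∃ x, pdist I x (φ i) = 1 ∧ hasZero (valuation I φ x) = false := by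
  obtain ⟨l, hl, hout, -⟩ := h.exists_outer_line hi
  obtain ⟨x, y, hxy, hx, hy⟩ := h.near.isPartialLinearSpace.two_points l
  by_cases e : x = φ i
  · exact ⟨y, pdist_eq_one_iff.2 ⟨e ▸ hxy.symm, l, hy, hl⟩, hout y hy (e ▸ hxy.symm)⟩
  · exact ⟨x, pdist_eq_one_iff.2 ⟨e, l, hx, hl⟩, hout x hx e⟩

theorem isCentral_or_isDouble (h : IsExtension I φ) {i : ℕ} (hi : i < 21) {x : P}
    (hx : pdist I x (φ i) = 1) (hx0 : hasZero (valuation I φ x) = false) :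
    isCentral (valuation I φ x) = true ∨ isDouble (valuation I φ x) = true := by
  have : i ∈ ones (valuation I φ x) := mem_ones.2 ⟨hi, by rw [h.digit_valuation _ hi, hx]⟩
  have := List.length_pos_of_mem this
  simp only [isCentral, isDouble, hx0, Bool.not_false, Bool.true_and, Nat.beq_eq, Nat.ble_eq]
  omega

/-- Points outside `H(2,1)` realize the codes in `spread`. -/
theorem exists_of_mem_spread (h : IsExtension I φ) {x : P} {a : ℕ}
    (hx0 : hasZero (valuation I φ x) = false) (ha : a ∈ spread (valuation I φ x)) :
    ∃ t, hasZero (valuation I φ t) = false ∧ valuation I φ t = a := by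
  rw [spread, List.mem_cons, List.mem_map] at ha
  rcases ha with rfl | ⟨i, hi, rfl⟩
  · exact ⟨x, hx0, rfl⟩
  · obtain ⟨hi, h1⟩ := mem_ones.1 hi
    rw [h.digit_valuation _ hi] at h1
    obtain ⟨t, -, h2, h3⟩ := h.exists_valuation_eq_third hi h1 hx0
    exact ⟨t, h2, h3⟩

theorem not_conflict (h : IsExtension I φ) {x y : P} (hx : hasZero (valuation I φ x) = false)
    (hy : hasZero (valuation I φ y) = false) :
    ¬ conflict (valuation I φ x) (valuation I φ y) = true := by
  simp only [conflict, List.any_eq_true, List.mem_range, Bool.and_eq_true, Nat.beq_eq,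
    Bool.not_eq_true', not_exists, not_and, and_imp]
  intro i hi hxi hyi hne hth
  rw [h.digit_valuation _ hi] at hxi hyi
  rcases h.valuation_eq_or_third hi hxi hx hyi hy with e | e
  · simp [e] at hne
  · simp [e] at hth

/-! ### Central points -/

theorem exists_isCentral (h : IsExtension I φ) :
    ∃ i < 21, ∃ x, pdist I x (φ i) = 1 ∧ isCentral (valuation I φ x) = true := by
  by_contra! hcon
  -- Without central points the outer line at every `i` supplies a double point; `gridCheck` makes
  -- the ones at `0` and at a suitable `u` force conflicting codes.
  have hdouble : ∀ i < 21, ∃ x, hasZero (valuation I φ x) = false ∧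
      (isDouble (valuation I φ x) && Nat.beq (digit (valuation I φ x) i) 1) = true := by
    intro i hi
    obtain ⟨x, hx, hx0⟩ := h.exists_outer_neighbour hi
    refine ⟨x, hx0, ?_⟩
    rw [h.digit_valuation _ hi, hx,
      (h.isCentral_or_isDouble hi hx hx0).resolve_left (hcon i hi x hx)]
    rfl
  have hc : gridCheck valuations = true := gridCheck_valuations
  obtain ⟨x, hx0, hx⟩ := hdouble 0 (by norm_num)
  rw [gridCheck, List.all_eq_true] at hc
  have hc := hc _ (h.valuation_mem x)
  rw [hx, Bool.not_true, Bool.false_or, List.any_eq_true] at hc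
  obtain ⟨u, hu, hc⟩ := hc
  obtain ⟨y, hy0, hy⟩ := hdouble u (List.mem_range.1 hu)
  rw [List.all_eq_true] at hc
  have hc := hc _ (h.valuation_mem y)
  rw [hy, Bool.not_true, Bool.false_or, List.any_eq_true] at hc
  obtain ⟨a, ha, hc⟩ := hc
  rw [List.any_eq_true] at hc
  obtain ⟨b, hb, hc⟩ := hc
  obtain ⟨x', hx', rfl⟩ := h.exists_of_mem_spread hx0 ha
  obtain ⟨y', hy', rfl⟩ := h.exists_of_mem_spread hy0 hb
  exact h.not_conflict hx' hy' hc

/-- The search runs over the neighbours of the double point `x`, among which `z` would occur. -/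
theorem not_isDouble_of_adj (h : IsExtension I φ) {x z : P} (hxz : (collinearityGraph I).Adj z x)
    (hz : isCentral (valuation I φ z) = true) : isDouble (valuation I φ x) = false := by
  rw [Bool.eq_false_iff]
  intro hx
  have hc : doubleCheck valuations = true := doubleCheck_valuations
  rw [doubleCheck, List.all_eq_true] at hc
  have hc := hc _ (h.valuation_mem x)
  rw [hx, Bool.not_true, Bool.false_or] at hc
  obtain ⟨N, hN, hmem⟩ := h.exists_neighbour_list (fun y _ => h.valuation_mem y) hc
  rw [List.all_eq_true] at hN
  have := hN _ ((hmem _).2 ⟨z, hxz.symm, rfl⟩)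
  simp [hz] at this

/-- By `not_isDouble_of_adj` the search around `z` may discard all double codes. -/
theorem neighbours_of_isCentral (h : IsExtension I φ) {z : P}
    (hz : isCentral (valuation I φ z) = true) :
    (∀ x, (collinearityGraph I).Adj z x → valuation I φ x ∈ regular valuations) ∧
    ∀ c ∈ regular valuations, onLine (regular valuations) (valuation I φ z) c = true →
      ∃ x, (collinearityGraph I).Adj z x ∧ valuation I φ x = c := by
  have hc : centralCheck valuations = true := centralCheck_valuations
  rw [centralCheck, List.all_eq_true] at hc
  have hc := hc _ (h.valuation_mem z)
  rw [hz, Bool.not_true, Bool.false_or] at hc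
  obtain ⟨N, hN, hmem⟩ := h.exists_neighbour_list (fun y hy => List.mem_filter.2
    ⟨h.valuation_mem y, by rw [h.not_isDouble_of_adj hy hz]; rfl⟩) hc
  simp only [Bool.and_eq_true, List.all_eq_true, mem_iff, Bool.or_eq_true,
    Bool.not_eq_true'] at hN
  refine ⟨fun x hx => hN.1 _ ((hmem _).2 ⟨x, hx, rfl⟩), fun c hc hl => (hmem c).1 ?_⟩
  rcases hN.2 c hc with h' | h'
  · rw [hl] at h'
    cases h'
  · exact h'

theorem isCentral_third (h : IsExtension I φ) {i : ℕ} (hi : i < 21) {z : P}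
    (hz : isCentral (valuation I φ z) = true) (hzi : pdist I z (φ i) = 1) :
    third (hrow i) (valuation I φ z) ≠ valuation I φ z ∧
    isCentral (third (hrow i) (valuation I φ z)) = true ∧
    ∀ c ∈ valuations, isCentral c = true → digit c i = 1 →
      c = valuation I φ z ∨ c = third (hrow i) (valuation I φ z) := by
  have hc : pairCheck valuations = true := pairCheck_valuations
  rw [pairCheck, List.all_eq_true] at hc
  have hc := hc _ (h.valuation_mem z)
  rw [hz, Bool.not_true, Bool.false_or, List.all_eq_true] at hc
  have hc := hc i (mem_ones.2 ⟨hi, by rw [h.digit_valuation _ hi, hzi]⟩)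
  simp only [Bool.and_eq_true, List.all_eq_true, Bool.or_eq_true, Bool.not_eq_true',
    Nat.beq_eq, Bool.eq_false_iff, Ne] at hc
  refine ⟨fun e => hc.1.1 e, hc.1.2, fun c hc' h1 h2 => ?_⟩
  rcases hc.2 c hc' with (h' | h') | h'
  · exact absurd ⟨h1, h2⟩ h'
  · exact Or.inl h'
  · exact Or.inr h'

theorem hasZero_eq_false_of_isCentral {c : ℕ} (hc : isCentral c = true) : hasZero c = false := by
  simp only [isCentral, Bool.and_eq_true, Bool.not_eq_true'] at hc
  exact hc.1

/-- One of the two outer points next to `φ i`, both central, has a neighbour that is central and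
next to `φ k`. -/
theorem exists_isCentral_of_opposite (h : IsExtension I φ) {i k : ℕ} (hi : i < 21) (hk : k < 21)
    (hik : hdist i k = 3)
    (hc : ∃ x, pdist I x (φ i) = 1 ∧ isCentral (valuation I φ x) = true) :
    ∃ x, pdist I x (φ k) = 1 ∧ isCentral (valuation I φ x) = true := by
  obtain ⟨z, hzi, hz⟩ := hc
  have hc : oppositeCheck valuations = true := oppositeCheck_valuations
  rw [oppositeCheck, List.all_eq_true] at hc
  have hc := hc _ (h.valuation_mem z)
  rw [hz, Bool.not_true, Bool.false_or, List.all_eq_true] at hc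
  have hc := hc i (mem_ones.2 ⟨hi, by rw [h.digit_valuation _ hi, hzi]⟩)
  rw [List.all_eq_true] at hc
  have hc := hc k (List.mem_range.2 hk)
  simp only [hik, List.any_eq_true, Bool.and_eq_true, Bool.or_eq_true, Nat.beq_eq] at hc
  obtain ⟨w, hw, ⟨hw1, hw2⟩, hl⟩ := hc.resolve_left (by simp)
  have key : ∀ y, isCentral (valuation I φ y) = true →
      onLine (regular valuations) (valuation I φ y) w = true →
      ∃ x, pdist I x (φ k) = 1 ∧ isCentral (valuation I φ x) = true := by
    intro y hy hyl
    obtain ⟨x, -, rfl⟩ := (h.neighbours_of_isCentral hy).2 w hw hyl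
    exact ⟨x, by rw [← h.digit_valuation _ hk, hw2], hw1⟩
  rcases hl with hl | hl
  · exact key z hz hl
  · obtain ⟨t, -, -, ht⟩ := h.exists_valuation_eq_third hi hzi (hasZero_eq_false_of_isCentral hz)
    exact key t (ht ▸ (h.isCentral_third hi hz hzi).2.1) (ht ▸ hl)

/-- Any two points of H(2,1) have a common opposite point, so two propagation steps suffice. -/
theorem exists_isCentral_of_lt (h : IsExtension I φ) {k : ℕ} (hk : k < 21) :
    ∃ x, pdist I x (φ k) = 1 ∧ isCentral (valuation I φ x) = true := by
  have hcomb : ∀ i < 21, ∀ k < 21, ∃ m < 21, hdist i m = 3 ∧ hdist m k = 3 := by decide +kernel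
  obtain ⟨i, hi, hx⟩ := h.exists_isCentral
  obtain ⟨m, hm, him, hmk⟩ := hcomb i hi k hk
  exact h.exists_isCentral_of_opposite hm hk hmk (h.exists_isCentral_of_opposite hi hm him hx)

theorem mem_regular {c : ℕ} : c ∈ regular valuations ↔
    c ∈ valuations ∧ (hasZero c = true ∨ isCentral c = true) := by
  simp [regular]

theorem valuation_mem_regular_of_adj (h : IsExtension I φ) {z x : P}
    (hzx : (collinearityGraph I).Adj z x) (hz : valuation I φ z ∈ regular valuations) :
    valuation I φ x ∈ regular valuations := by
  rcases (mem_regular.1 hz).2 with h0 | h1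
  · obtain ⟨i, hi, rfl⟩ := h.hasZero_valuation_iff.1 h0
    refine mem_regular.2 ⟨h.valuation_mem x, ?_⟩
    by_cases hx0 : hasZero (valuation I φ x) = true
    · exact Or.inl hx0
    · rw [Bool.not_eq_true] at hx0
      obtain ⟨y, hyi, hy⟩ := h.exists_isCentral_of_lt hi
      rcases h.valuation_eq_or_third hi hyi (hasZero_eq_false_of_isCentral hy)
        (pdist_eq_one_iff.2 hzx.symm) hx0 with e | e
      · exact Or.inr (e ▸ hy)
      · exact Or.inr (e ▸ (h.isCentral_third hi hy hyi).2.1)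
  · exact (h.neighbours_of_isCentral h1).1 x hzx

/-! ### Reconstruction of the near hexagon from the codes -/

theorem valuation_mem_regular (h : IsExtension I φ) (z : P) :
    valuation I φ z ∈ regular valuations := by
  obtain ⟨p⟩ := h.near.connected (φ 0) z
  have hw : ∀ {a b : P} (_ : (collinearityGraph I).Walk a b),
      valuation I φ a ∈ regular valuations → valuation I φ b ∈ regular valuations := by
    intro a b p
    induction p with
    | nil => exact id
    | cons hab p ih => exact fun ha => ih (h.valuation_mem_regular_of_adj hab ha)
  exact hw p (mem_regular.2 ⟨h.valuation_mem _, Or.inl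
    (h.hasZero_valuation_iff.2 ⟨0, by norm_num, rfl⟩)⟩)

theorem exists_mem_ones {c : ℕ} (hc : isCentral c = true) : ∃ i < 21, digit c i = 1 := by
  simp only [isCentral, Bool.and_eq_true, Nat.beq_eq] at hc
  obtain ⟨i, hi⟩ := List.exists_mem_of_length_pos (hc.2 ▸ Nat.one_pos)
  exact ⟨i, mem_ones.1 hi⟩

/-- A zero of the code names the point. Points with the same central code lie on the same outer
line, whose two outer points have different codes by `isCentral_third`. -/
theorem valuation_injective (h : IsExtension I φ) : Function.Injective (valuation I φ) := by
  intro x y hxy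
  rcases (mem_regular.1 (h.valuation_mem_regular x)).2 with h0 | h1
  · obtain ⟨i, hi, rfl⟩ := h.hasZero_valuation_iff.1 h0
    refine (h.near.pdist_eq_zero_iff.1 ?_).symm
    rw [← h.digit_valuation _ hi, ← hxy, h.digit_valuation _ hi, h.near.pdist_eq_zero_iff]
  · obtain ⟨i, hi, hxi⟩ := exists_mem_ones h1
    have hyi := hxy ▸ hxi
    have hx0 := hasZero_eq_false_of_isCentral h1
    rw [h.digit_valuation _ hi] at hxi hyi
    rcases h.valuation_eq_or_third hi hxi hx0 hyi (hxy ▸ hx0) with e | e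
    · exact e.symm
    · exact absurd (e.symm.trans hxy.symm) (h.isCentral_third hi h1 hxi).1

/-- Only two central codes have the value 1 at `i`, and the outer line through `φ i` realizes both.
-/
theorem exists_valuation_eq (h : IsExtension I φ) {c : ℕ} (hc : c ∈ regular valuations) :
    ∃ x, valuation I φ x = c := by
  obtain ⟨hc, h0 | h1⟩ := mem_regular.1 hc
  · obtain ⟨i, hi, h0⟩ := hasZero_iff.1 h0
    have hz : zeroCheck valuations = true := zeroCheck_valuations
    simp only [zeroCheck, List.all_eq_true, List.mem_range] at hz
    have hz := hz c hc i hi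
    rw [h0] at hz
    exact ⟨φ i, (h.valuation_hpoint hi).trans (Nat.eq_of_beq_eq_true hz).symm⟩
  · obtain ⟨i, hi, hci⟩ := exists_mem_ones h1
    obtain ⟨y, hyi, hy⟩ := h.exists_isCentral_of_lt hi
    rcases (h.isCentral_third hi hy hyi).2.2 c hc h1 hci with e | e
    · exact ⟨y, e.symm⟩
    · obtain ⟨t, -, -, ht⟩ := h.exists_valuation_eq_third hi hyi (hasZero_eq_false_of_isCentral hy)
      exact ⟨t, ht.trans e.symm⟩

/-- In the reverse direction, compatibility with the code of `φ i` already means distance at most 1;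
at a central point every code allowed by `onLine` is that of a neighbour, and codes are injective.
-/
theorem adj_iff_onLine (h : IsExtension I φ) {x y : P} : (collinearityGraph I).Adj x y ↔
    valuation I φ x ≠ valuation I φ y ∧
      onLine (regular valuations) (valuation I φ x) (valuation I φ y) = true := by
  constructor
  · exact fun hxy => ⟨fun e => hxy.1 (h.valuation_injective e),
      h.onLine_of_adj hxy fun z _ => h.valuation_mem_regular z⟩
  · rintro ⟨hne, hl⟩
    rcases (mem_regular.1 (h.valuation_mem_regular x)).2 with h0 | h1
    · obtain ⟨i, hi, rfl⟩ := h.hasZero_valuation_iff.1 h0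
      rw [onLine, Bool.and_eq_true] at hl
      have := (compat_encode_iff (fun i _ => h.pdist_lt _ _) fun i _ => h.pdist_lt _ _).1 hl.1 i hi
      rw [h.near.pdist_eq_zero_iff.2 rfl] at this
      have h0 : pdist I y (φ i) ≠ 0 := fun e => hne (by rw [h.near.pdist_eq_zero_iff.1 e])
      exact (pdist_eq_one_iff.1 (by omega)).symm
    · obtain ⟨z, hz, e⟩ := (h.neighbours_of_isCentral h1).2 _ (h.valuation_mem_regular y) hl
      exact h.valuation_injective e ▸ hz

noncomputable def equivRegular (h : IsExtension I φ) : P ≃ {c // c ∈ regular valuations} :=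
  Equiv.ofBijective (fun x => ⟨valuation I φ x, h.valuation_mem_regular x⟩)
    ⟨fun _ _ e => h.valuation_injective (Subtype.ext_iff.1 e), fun c =>
      (h.exists_valuation_eq c.2).imp fun _ hx => Subtype.ext hx⟩

theorem isomorphic {P' L' : Type*} {I' : P' → L' → Prop} {φ' : ℕ → P'} (h : IsExtension I φ)
    (h' : IsExtension I' φ') : Isomorphic I I' := by
  have key : ∀ x, valuation I' φ' ((h.equivRegular.trans h'.equivRegular.symm) x) =
      valuation I φ x := fun x =>
    congrArg Subtype.val (h'.equivRegular.apply_symm_apply (h.equivRegular x))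
  refine Isomorphic.of_adj_iff h.near h.order h'.near h'.order
    (h.equivRegular.trans h'.equivRegular.symm) fun x y => ?_
  rw [h.adj_iff_onLine, h'.adj_iff_onLine, key, key]

end IsExtension

/-! ### Binary coordinates -/

def bitValue (b : Bool) : ZMod 2 := if b then 1 else 0

theorem bitValue_xor (b c : Bool) : bitValue (b ^^ c) = bitValue b + bitValue c := by
  revert b c; decide

theorem bitValue_and (b c : Bool) : bitValue (b && c) = bitValue b * bitValue c := by
  revert b c; decide

theorem bitValue_injective : Function.Injective bitValue := by
  unfold Function.Injective; decide

/-- The vector over the field with two elements whose coordinates are the binary digits of `n`. -/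
def bits (d n : ℕ) : Fin d → ZMod 2 := fun i => bitValue (n.testBit i)

theorem bits_xor (d a b : ℕ) : bits d (a ^^^ b) = bits d a + bits d b := by
  funext i
  simp [bits, bitValue_xor]

theorem bits_zero (d : ℕ) : bits d 0 = 0 := by
  funext i
  simp [bits, bitValue]

theorem bits_inj {d a b : ℕ} (ha : a < 2 ^ d) (hb : b < 2 ^ d) : bits d a = bits d b ↔ a = b := by
  refine ⟨fun h => Nat.eq_of_testBit_eq fun i => ?_, fun h => h ▸ rfl⟩
  rcases Nat.lt_or_ge i d with hi | hi
  · exact bitValue_injective (congrFun h ⟨i, hi⟩)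
  · rw [Nat.testBit_lt_two_pow (ha.trans_le (Nat.pow_le_pow_right (by norm_num) hi)),
      Nat.testBit_lt_two_pow (hb.trans_le (Nat.pow_le_pow_right (by norm_num) hi))]

theorem exists_bits_eq {d : ℕ} (x : Fin d → ZMod 2) : ∃ n < 2 ^ d, bits d n = x := by
  have h : Function.Bijective fun n : Fin (2 ^ d) => bits d n := by
    refine (Fintype.bijective_iff_injective_and_card _).2 ⟨fun a b hab => ?_, by simp [ZMod.card]⟩
    exact Fin.ext ((bits_inj a.2 b.2).1 hab)
  obtain ⟨n, hn⟩ := h.2 x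
  exact ⟨n, n.2, hn⟩

theorem bits_ne_zero {d a : ℕ} (ha : a < 2 ^ d) : bits d a ≠ 0 ↔ a ≠ 0 := by
  rw [← bits_zero, Ne, bits_inj ha (by positivity)]

/-! ### The points of `H(2,1)` -/

def oddDot (a b : ℕ) : Bool :=
  (a.testBit 0 && b.testBit 0) ^^ (a.testBit 1 && b.testBit 1) ^^ (a.testBit 2 && b.testBit 2)

theorem bits_dotProduct (a b : ℕ) : bits 3 a ⬝ᵥ bits 3 b = bitValue (oddDot a b) := by
  simp [dotProduct, Fin.sum_univ_three, bits, oddDot, bitValue_xor, bitValue_and, add_assoc]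

/-- The default `(1, 2)` is never used, since the list has 21 entries. -/
theorem exists_flagCodes (e : FanoFlag) :
    ∃ i < 21, e.1.1.1 = bits 3 (flagCodes.getD i (1, 2)).1 ∧
      e.1.2.1 = bits 3 (flagCodes.getD i (1, 2)).2 := by
  obtain ⟨⟨⟨x, hx⟩, ⟨y, hy⟩⟩, he⟩ := e
  obtain ⟨a, ha, rfl⟩ := exists_bits_eq x
  obtain ⟨b, hb, rfl⟩ := exists_bits_eq y
  rw [bits_ne_zero ha] at hx
  rw [bits_ne_zero hb] at hy
  have hcomb : ∀ a < 2 ^ 3, ∀ b < 2 ^ 3, a ≠ 0 ∧ b ≠ 0 ∧ oddDot b a = false →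
      ∃ i < 21, flagCodes.getD i (1, 2) = (a, b) := by decide +kernel
  have : oddDot b a = false := bitValue_injective ((bits_dotProduct b a).symm.trans he)
  obtain ⟨i, hi, h⟩ := hcomb a ha b hb ⟨hx, hy, this⟩
  exact ⟨i, hi, by rw [h], by rw [h]⟩

theorem flagCodes_bounds : ∀ i < 21, (flagCodes.getD i (1, 2)).1 < 2 ^ 3 ∧
    (flagCodes.getD i (1, 2)).2 < 2 ^ 3 ∧ (flagCodes.getD i (1, 2)).1 ≠ 0 ∧
    (flagCodes.getD i (1, 2)).2 ≠ 0 ∧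
    oddDot (flagCodes.getD i (1, 2)).2 (flagCodes.getD i (1, 2)).1 = false := by
  decide +kernel

theorem exists_flag {i : ℕ} (hi : i < 21) :
    ∃ e : FanoFlag, e.1.1.1 = bits 3 (flagCodes.getD i (1, 2)).1 ∧
      e.1.2.1 = bits 3 (flagCodes.getD i (1, 2)).2 := by
  obtain ⟨h1, h2, h3, h4, h5⟩ := flagCodes_bounds i hi
  exact ⟨⟨⟨⟨_, (bits_ne_zero h1).2 h3⟩, ⟨_, (bits_ne_zero h2).2 h4⟩⟩,
    by rw [bits_dotProduct, h5]; rfl⟩, rfl, rfl⟩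

/-- The number of a flag in the list `flagCodes`. -/
noncomputable def flagIndex (e : FanoFlag) : ℕ := (exists_flagCodes e).choose

theorem flagIndex_lt (e : FanoFlag) : flagIndex e < 21 := (exists_flagCodes e).choose_spec.1

theorem flag_fst (e : FanoFlag) : e.1.1.1 = bits 3 (flagCodes.getD (flagIndex e) (1, 2)).1 :=
  (exists_flagCodes e).choose_spec.2.1

theorem flag_snd (e : FanoFlag) : e.1.2.1 = bits 3 (flagCodes.getD (flagIndex e) (1, 2)).2 :=
  (exists_flagCodes e).choose_spec.2.2

theorem flagIndex_injective : Function.Injective flagIndex := fun e f h =>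
  Subtype.ext (Prod.ext (Subtype.ext (by rw [flag_fst, flag_fst, h]))
    (Subtype.ext (by rw [flag_snd, flag_snd, h])))

theorem exists_flagIndex_eq {i : ℕ} (hi : i < 21) : ∃ e, flagIndex e = i := by
  obtain ⟨e, h1, h2⟩ := exists_flag hi
  refine ⟨e, ?_⟩
  have b1 := flagCodes_bounds i hi
  have b2 := flagCodes_bounds _ (flagIndex_lt e)
  rw [flag_fst, bits_inj b2.1 b1.1] at h1
  rw [flag_snd, bits_inj b2.2.1 b1.2.1] at h2
  have hcomb : ∀ i < 21, ∀ j < 21, (flagCodes.getD i (1, 2)).1 = (flagCodes.getD j (1, 2)).1 →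
      (flagCodes.getD i (1, 2)).2 = (flagCodes.getD j (1, 2)).2 → i = j := by decide +kernel
  exact hcomb _ (flagIndex_lt e) i hi h1 h2

/-- Distinct flags are collinear when they share their point or their line. -/
theorem H21_adj_iff {e f : FanoFlag} : (collinearityGraph H21).Adj e f ↔
    hdist (flagIndex e) (flagIndex f) = 1 := by
  have hcomb : ∀ i < 21, ∀ j < 21, hdist i j = 1 ↔
      ((flagCodes.getD i (1, 2)).1 = (flagCodes.getD j (1, 2)).1 ∨
        (flagCodes.getD i (1, 2)).2 = (flagCodes.getD j (1, 2)).2) ∧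
      ¬ ((flagCodes.getD i (1, 2)).1 = (flagCodes.getD j (1, 2)).1 ∧
        (flagCodes.getD i (1, 2)).2 = (flagCodes.getD j (1, 2)).2) := by decide +kernel
  have be := flagCodes_bounds _ (flagIndex_lt e)
  have bf := flagCodes_bounds _ (flagIndex_lt f)
  rw [hcomb _ (flagIndex_lt e) _ (flagIndex_lt f), ← bits_inj be.1 bf.1, ← bits_inj be.2.1 bf.2.1,
    ← flag_fst, ← flag_fst, ← flag_snd, ← flag_snd, ← Subtype.ext_iff, ← Subtype.ext_iff]
  have hne : e = f ↔ e.1.1 = f.1.1 ∧ e.1.2 = f.1.2 := by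
    rw [Subtype.ext_iff, Prod.ext_iff]
  have hl : (∃ l, H21 e l ∧ H21 f l) ↔ e.1.1 = f.1.1 ∨ e.1.2 = f.1.2 := by
    simp [H21, dual, fanoGraphInc, eq_comm]
  change e ≠ f ∧ (∃ l, H21 e l ∧ H21 f l) ↔ _
  rw [hl, Ne, hne, and_comm]

theorem pdist_H21 (e f : FanoFlag) : pdist H21 e f = hdist (flagIndex e) (flagIndex f) := by
  have hlt := flagIndex_lt
  have h0 : ∀ i < 21, hdist i i = 0 := by decide +kernel
  have hz : ∀ i < 21, ∀ j < 21, hdist i j = 0 → i = j := by decide +kernel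
  have hlip : ∀ i < 21, ∀ j < 21, ∀ k < 21, hdist j k = 1 → hdist i k ≤ hdist i j + 1 := by
    decide +kernel
  have hdesc : ∀ i < 21, ∀ j < 21, hdist i j ≠ 0 →
      ∃ k < 21, hdist j k = 1 ∧ hdist i k + 1 = hdist i j := by decide +kernel
  refine (dist_eq_of_lipschitz_of_descent
    (D := fun e f => hdist (flagIndex e) (flagIndex f)) (fun e => h0 _ (hlt e))
    (fun e f h => flagIndex_injective (hz _ (hlt e) _ (hlt f) h))
    (fun e f g h => hlip _ (hlt e) _ (hlt f) _ (hlt g) (H21_adj_iff.1 h)) (fun e f h => ?_) e f).2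
  obtain ⟨k, hk, h1, h2⟩ := hdesc _ (hlt e) _ (hlt f) h
  obtain ⟨g, rfl⟩ := exists_flagIndex_eq hk
  exact ⟨g, H21_adj_iff.2 h1, h2⟩

/-- Only the distances of the embedding are kept; they already determine which points of the copy
are collinear. -/
theorem exists_isExtension {P L : Type*} {I : P → L → Prop} (hI : IsNearHexagon I)
    (hO : HasOrder I 2 2) (hE : IsometricallyEmbeds H21 I) : ∃ φ, IsExtension I φ := by
  obtain ⟨f, g, -, -, -, hd⟩ := hE
  have : ∀ i, ∃ e, i < 21 → flagIndex e = i := fun i => by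
    by_cases hi : i < 21
    · exact (exists_flagIndex_eq hi).imp fun e he _ => he
    · exact ⟨(exists_flagIndex_eq (i := 0) (by norm_num)).choose, fun h => absurd h hi⟩
  choose F hF using this
  refine ⟨fun i => f (F i), hI, hO, fun i hi j hj => ?_⟩
  rw [← hd, pdist_H21, hF i hi, hF j hj]

/-! ### The dual split Cayley hexagon

Points of `PG(6,2)` are coded by their binary coordinates, lines of `H(2)` by the number that has
a binary digit `1` at the places given by the codes of its points. -/

/-- Over the field with two elements `X₃²` is `X₃`, and signs do not matter. -/
def quadBit (a : ℕ) : Bool :=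
  (a.testBit 0 && a.testBit 4) ^^ (a.testBit 1 && a.testBit 5) ^^ (a.testBit 2 && a.testBit 6) ^^
    a.testBit 3

def grassmannBit (a b i j : ℕ) : Bool :=
  (a.testBit i && b.testBit j) ^^ (a.testBit j && b.testBit i)

def titsTest (a b : ℕ) : Bool :=
  !(grassmannBit a b 1 2 ^^ grassmannBit a b 3 4) &&
  !(grassmannBit a b 5 4 ^^ grassmannBit a b 3 2) &&
  !(grassmannBit a b 2 0 ^^ grassmannBit a b 3 5) &&
  !(grassmannBit a b 6 5 ^^ grassmannBit a b 3 0) &&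
  !(grassmannBit a b 0 1 ^^ grassmannBit a b 3 6) &&
  !(grassmannBit a b 4 6 ^^ grassmannBit a b 3 1)

def isQuadricPoint (a : ℕ) : Bool := !Nat.beq a 0 && !quadBit a

def hexPoints : List ℕ := (List.range 128).filter isQuadricPoint

def lineMask (a b : ℕ) : ℕ := 2 ^ a ||| 2 ^ b ||| 2 ^ (a ^^^ b)

def hexLineTest (a b : ℕ) : Bool :=
  !Nat.beq a b && isQuadricPoint (a ^^^ b) && titsTest a b

/-- The points of a line are taken in decreasing order, so that each line is listed once. -/
def hexLines : List ℕ := hexPoints.flatMap fun a =>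
  (hexPoints.filter fun b => Nat.ble b a && Nat.ble (a ^^^ b) b && hexLineTest a b).map (lineMask a)

def pointLines (a : ℕ) : List ℕ := hexLines.filter fun m => m.testBit a

/-- The points on the lines that meet the line `m`. -/
def neighbourhood (m : ℕ) : ℕ :=
  hexLines.foldr (fun n s => bif Nat.beq (n &&& m) 0 then s else n ||| s) 0

/-- The value 3 stands for every remaining pair; `pencilTest_pointLines` and `lineDist_descent`
confirm that this is the distance. -/
def lineDist (m n : ℕ) : ℕ :=
  bif Nat.beq m n then 0 else bif !Nat.beq (m &&& n) 0 then 1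
  else bif !Nat.beq (neighbourhood m &&& n) 0 then 2 else 3

def pencilTest (a : ℕ) : List ℕ → Bool
  | [x, y, z] => !Nat.beq x y && !Nat.beq z x && !Nat.beq z y && Nat.beq (x &&& y) (2 ^ a) &&
      Nat.beq (x &&& z) (2 ^ a) && Nat.beq (y &&& z) (2 ^ a) &&
      hexLines.all fun m => linePattern (lineDist m x) (lineDist m y) (lineDist m z)
  | _ => false

theorem pencilTest_pointLines : (hexPoints.all fun a => pencilTest a (pointLines a)) = true := by
  decide +kernel

theorem lineDist_descent : (hexLines.all fun m => hexLines.all fun n =>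
    Nat.beq (lineDist m n) 0 || hexLines.any fun k =>
      !Nat.beq (k &&& n) 0 && !Nat.beq k n &&
        Nat.beq (lineDist m k + 1) (lineDist m n)) = true := by
  decide +kernel

/-- Removes the ordering condition in `hexLines`: any two spanning points give a listed mask. -/
theorem lineMask_mem_hexLines : (hexPoints.all fun a => hexPoints.all fun b =>
    !hexLineTest a b || mem (lineMask a b) hexLines) = true := by
  decide +kernel

theorem not_beq_iff {a b : ℕ} : (!Nat.beq a b) = true ↔ a ≠ b := by
  cases h : Nat.beq a b
  · simpa using Nat.ne_of_beq_eq_false h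
  · simpa using Nat.eq_of_beq_eq_true h

theorem quadForm_bits (a : ℕ) : quadForm (bits 7 a) = bitValue (quadBit a) := by
  have h : ∀ b : Bool, bitValue b ^ 2 = bitValue b := by decide
  simp only [quadForm, quadBit, bitValue_xor, bitValue_and, CharTwo.sub_eq_add]
  rw [← h (a.testBit 3)]
  simp only [bits]
  norm_num [add_assoc]

theorem grassmann_bits (a b : ℕ) (i j : Fin 7) :
    grassmann (bits 7 a) (bits 7 b) i j = bitValue (grassmannBit a b i j) := by
  simp only [grassmann, grassmannBit, bitValue_xor, bitValue_and, CharTwo.sub_eq_add, bits]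

theorem isQuadricPoint_iff {a : ℕ} (ha : a < 2 ^ 7) :
    isQuadricPoint a = true ↔ bits 7 a ≠ 0 ∧ quadForm (bits 7 a) = 0 := by
  rw [bits_ne_zero ha, quadForm_bits, ← show bitValue false = 0 from rfl,
    bitValue_injective.eq_iff]
  rw [isQuadricPoint, Bool.and_eq_true, not_beq_iff, Bool.not_eq_true']

theorem spanHexagonLine_bits {a b : ℕ} (ha : a < 2 ^ 7) (hb : b < 2 ^ 7) :
    SpanHexagonLine (bits 7 a) (bits 7 b) ↔
      isQuadricPoint a = true ∧ isQuadricPoint b = true ∧ hexLineTest a b = true := by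
  have hab : a ^^^ b < 2 ^ 7 := Nat.xor_lt_two_pow ha hb
  have hx : ∀ c d : Bool, (!(c ^^ d)) = true ↔ c = d := by decide
  have hne : bits 7 a ≠ bits 7 b ↔ bits 7 a + bits 7 b ≠ 0 := by
    rw [Ne, Ne, CharTwo.add_eq_zero]
  have hbeq : (!Nat.beq a b) = true ↔ bits 7 a ≠ bits 7 b := by
    rw [not_beq_iff, Ne, Ne, bits_inj ha hb]
  simp only [SpanHexagonLine, grassmann_bits, bitValue_injective.eq_iff, hexLineTest, titsTest,
    Bool.and_eq_true, hx, isQuadricPoint_iff ha, isQuadricPoint_iff hb, isQuadricPoint_iff hab,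
    bits_xor, hbeq]
  rw [← hne]
  constructor
  · rintro ⟨h1, h2, h3, h4, h5, h6, h7, h8, h9, h10, h11, h12⟩
    exact ⟨⟨h1, h4⟩, ⟨h2, h5⟩, ⟨h3, h3, h6⟩, ⟨⟨⟨⟨h7, h8⟩, h9⟩, h10⟩, h11⟩, h12⟩
  · rintro ⟨⟨h1, h4⟩, ⟨h2, h5⟩, ⟨h3, -, h6⟩, ⟨⟨⟨⟨h7, h8⟩, h9⟩, h10⟩, h11⟩, h12⟩
    exact ⟨h1, h2, h3, h4, h5, h6, h7, h8, h9, h10, h11, h12⟩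

theorem mem_hexPoints {a : ℕ} : a ∈ hexPoints ↔ a < 2 ^ 7 ∧ isQuadricPoint a = true := by
  rw [hexPoints, List.mem_filter, List.mem_range]
  exact Iff.rfl

theorem testBit_lineMask {a b n : ℕ} :
    (lineMask a b).testBit n = true ↔ n = a ∨ n = b ∨ n = a ^^^ b := by
  rw [lineMask, Nat.testBit_or, Nat.testBit_or, Nat.testBit_two_pow, Nat.testBit_two_pow,
    Nat.testBit_two_pow, Bool.or_eq_true, Bool.or_eq_true, decide_eq_true_eq, decide_eq_true_eq,
    decide_eq_true_eq, or_assoc, eq_comm (a := a), eq_comm (a := b), eq_comm (a := a ^^^ b)]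

/-- The binary digits of `m` are given by the codes of the points of `l`. -/
def IsMask (l : CayleyLine) (m : ℕ) : Prop :=
  ∀ n, m.testBit n = true ↔ n < 2 ^ 7 ∧ bits 7 n ∈ l.1

theorem isMask_lineMask {l : CayleyLine} {a b : ℕ} (ha : a < 2 ^ 7) (hb : b < 2 ^ 7)
    (hl : l.1 = {bits 7 a, bits 7 b, bits 7 a + bits 7 b}) : IsMask l (lineMask a b) := by
  intro n
  have hab : a ^^^ b < 2 ^ 7 := Nat.xor_lt_two_pow ha hb
  rw [testBit_lineMask, hl, ← bits_xor]
  simp only [Finset.mem_insert, Finset.mem_singleton]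
  constructor
  · rintro (rfl | rfl | rfl)
    exacts [⟨ha, by simp⟩, ⟨hb, by simp⟩, ⟨hab, by simp⟩]
  · rintro ⟨hn, h⟩
    rwa [bits_inj hn ha, bits_inj hn hb, bits_inj hn hab] at h

theorem exists_isMask (l : CayleyLine) : ∃ m ∈ hexLines, IsMask l m := by
  obtain ⟨s, x, y, h, hs⟩ := l
  obtain ⟨a, ha, rfl⟩ := exists_bits_eq x
  obtain ⟨b, hb, rfl⟩ := exists_bits_eq y
  obtain ⟨h1, h2, h3⟩ := (spanHexagonLine_bits ha hb).1 h
  refine ⟨lineMask a b, ?_, isMask_lineMask ha hb hs⟩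
  have := lineMask_mem_hexLines
  rw [List.all_eq_true] at this
  have := this a (mem_hexPoints.2 ⟨ha, h1⟩)
  rw [List.all_eq_true] at this
  have := this b (mem_hexPoints.2 ⟨hb, h2⟩)
  rwa [h3, Bool.not_true, Bool.false_or, mem_iff] at this

noncomputable def mask (l : CayleyLine) : ℕ := (exists_isMask l).choose

theorem mask_mem (l : CayleyLine) : mask l ∈ hexLines := (exists_isMask l).choose_spec.1

theorem isMask_mask (l : CayleyLine) : IsMask l (mask l) := (exists_isMask l).choose_spec.2

theorem IsMask.eq {l : CayleyLine} {m : ℕ} (h : IsMask l m) : mask l = m :=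
  Nat.eq_of_testBit_eq fun i => Bool.eq_iff_iff.2 ((isMask_mask l i).trans (h i).symm)

theorem mask_injective : Function.Injective mask := by
  intro l l' h
  refine Subtype.ext (Finset.ext fun x => ?_)
  obtain ⟨n, hn, rfl⟩ := exists_bits_eq x
  have h1 := isMask_mask l n
  have h2 := isMask_mask l' n
  rw [h, h2] at h1
  simp only [hn, true_and] at h1
  exact h1.symm

theorem exists_mask_eq {m : ℕ} (hm : m ∈ hexLines) : ∃ l, mask l = m := by
  simp only [hexLines, List.mem_flatMap, List.mem_map, List.mem_filter, Bool.and_eq_true] at hm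
  obtain ⟨a, ha, b, ⟨hb, -, hab⟩, rfl⟩ := hm
  obtain ⟨ha, ha'⟩ := mem_hexPoints.1 ha
  obtain ⟨hb, hb'⟩ := mem_hexPoints.1 hb
  exact ⟨⟨_, _, _, (spanHexagonLine_bits ha hb).2 ⟨ha', hb', hab⟩, rfl⟩,
    (isMask_lineMask ha hb rfl).eq⟩

theorem exists_code (x : CayleyPoint) : ∃ a ∈ hexPoints, x.1 = bits 7 a ∧
    ∀ l, H2D l x ↔ (mask l).testBit a = true := by
  obtain ⟨a, ha, h⟩ := exists_bits_eq x.1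
  refine ⟨a, mem_hexPoints.2 ⟨ha, (isQuadricPoint_iff ha).2 (h ▸ x.2)⟩, h.symm, fun l => ?_⟩
  rw [isMask_mask l a, h]
  exact ⟨fun hl => ⟨ha, hl⟩, fun hl => hl.2⟩

theorem isCayleyPoint_of_mem {l : CayleyLine} {x : Fin 7 → ZMod 2} (hx : x ∈ l.1) :
    x ≠ 0 ∧ quadForm x = 0 := by
  obtain ⟨y, z, ⟨h1, h2, h3, h4, h5, h6, -⟩, hs⟩ := l.2
  rw [hs] at hx
  simp only [Finset.mem_insert, Finset.mem_singleton] at hx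
  rcases hx with rfl | rfl | rfl
  · exact ⟨h1, h4⟩
  · exact ⟨h2, h5⟩
  · exact ⟨fun h => h3 (CharTwo.add_eq_zero.1 h), h6⟩

theorem H2D_adj_of_mask {l m : CayleyLine} (hne : mask l ≠ mask m) (h : mask l &&& mask m ≠ 0) :
    (collinearityGraph H2D).Adj l m := by
  obtain ⟨n, hn⟩ := Nat.exists_testBit_of_ne_zero h
  rw [Nat.testBit_and, Bool.and_eq_true] at hn
  obtain ⟨-, h1⟩ := (isMask_mask l n).1 hn.1
  obtain ⟨-, h2⟩ := (isMask_mask m n).1 hn.2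
  exact ⟨fun e => hne (by rw [e]), ⟨_, isCayleyPoint_of_mem h1⟩, h1, h2⟩

/-- Transfers `pencilTest` from masks to H(2)^D, where `x` is a line and the `lᵢ` are its points. -/
theorem exists_pencil (x : CayleyPoint) : ∃ l₁ l₂ l₃, l₁ ≠ l₂ ∧ l₃ ≠ l₁ ∧ l₃ ≠ l₂ ∧
    (∀ l, H2D l x ↔ l = l₁ ∨ l = l₂ ∨ l = l₃) ∧
    (∀ l, linePattern (lineDist (mask l) (mask l₁)) (lineDist (mask l) (mask l₂))
      (lineDist (mask l) (mask l₃)) = true) ∧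
    ∀ l l', H2D l x → H2D l' x → l ≠ l' → ∀ y, H2D l y → H2D l' y → y = x := by
  obtain ⟨a, ha, hxa, hinc⟩ := exists_code x
  have h := pencilTest_pointLines
  rw [List.all_eq_true] at h
  have h := h a ha
  unfold pencilTest at h
  split at h
  next m₁ m₂ m₃ hm =>
    have hmem : ∀ m, m ∈ hexLines ∧ m.testBit a = true ↔ m = m₁ ∨ m = m₂ ∨ m = m₃ := fun m => by
      have : m ∈ pointLines a ↔ m ∈ hexLines ∧ m.testBit a = true := by
        rw [pointLines, List.mem_filter]
      rw [← this, hm]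
      simp
    obtain ⟨l₁, rfl⟩ := exists_mask_eq ((hmem m₁).2 (by simp)).1
    obtain ⟨l₂, rfl⟩ := exists_mask_eq ((hmem m₂).2 (by simp)).1
    obtain ⟨l₃, rfl⟩ := exists_mask_eq ((hmem m₃).2 (by simp)).1
    simp only [Bool.and_eq_true, not_beq_iff, Nat.beq_eq, List.all_eq_true] at h
    obtain ⟨⟨⟨⟨⟨⟨h₁₂, h₃₁⟩, h₃₂⟩, e₁₂⟩, e₁₃⟩, e₂₃⟩, hp⟩ := h
    have hl : ∀ l, H2D l x ↔ l = l₁ ∨ l = l₂ ∨ l = l₃ := fun l => by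
      have := hmem (mask l)
      rw [mask_injective.eq_iff, mask_injective.eq_iff, mask_injective.eq_iff, ← hinc] at this
      exact ⟨fun h => this.1 ⟨mask_mem l, h⟩, fun h => (this.2 h).2⟩
    refine ⟨l₁, l₂, l₃, fun e => h₁₂ (by rw [e]), fun e => h₃₁ (by rw [e]),
      fun e => h₃₂ (by rw [e]), hl, fun l => hp _ (mask_mem l),
      fun l l' hlx hlx' hne y hy hy' => ?_⟩
    obtain ⟨b, hb, hyb, hinc'⟩ := exists_code y
    have key : mask l &&& mask l' = 2 ^ a := by
      rcases (hl l).1 hlx with rfl | rfl | rfl <;> rcases (hl l').1 hlx' with rfl | rfl | rfl <;>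
        first | exact absurd rfl hne | assumption | (rw [Nat.and_comm]; assumption)
    have hbit := congrArg (fun m => Nat.testBit m b) key
    simp only [Nat.testBit_and, (hinc' l).1 hy, (hinc' l').1 hy', Nat.testBit_two_pow] at hbit
    have hab : a = b := by simpa using hbit
    exact Subtype.ext (by rw [hxa, hyb, hab])
  next => cases h

theorem isNearHexagon_H2D_and_pdist :
    IsNearHexagon H2D ∧ ∀ l m, pdist H2D l m = lineDist (mask l) (mask m) := by
  -- This pair makes the diameter exactly 3.
  obtain ⟨m₀, hm₀, n₀, hn₀, h₃⟩ : ∃ m ∈ hexLines, ∃ n ∈ hexLines, lineDist m n = 3 := by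
    decide +kernel
  obtain ⟨l₀, rfl⟩ := exists_mask_eq hm₀
  obtain ⟨k₀, rfl⟩ := exists_mask_eq hn₀
  refine IsNearPolygon.of_linePattern ⟨l₀⟩ _ ?_ (fun l => ?_) (fun l m h => ?_) (fun x => ?_)
    (fun l m h => ?_) (fun l m => ?_) ⟨l₀, k₀, h₃⟩
  · intro l m hne x y hl hm hl' hm'
    obtain ⟨-, -, -, -, -, -, -, -, h⟩ := exists_pencil x
    exact (h l m hl hm hne y hl' hm').symm
  · simp [lineDist]
  · by_contra hne
    have : Nat.beq (mask l) (mask m) = false := by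
      rw [Bool.eq_false_iff]
      exact fun e => hne (mask_injective (Nat.eq_of_beq_eq_true e))
    cases h1 : Nat.beq (mask l &&& mask m) 0 <;>
      cases h2 : Nat.beq (neighbourhood (mask l) &&& mask m) 0 <;>
      simp [lineDist, this, h1, h2] at h
  · obtain ⟨l₁, l₂, l₃, h₁₂, h₃₁, h₃₂, hl, hp, -⟩ := exists_pencil x
    exact ⟨l₁, l₂, l₃, h₁₂, h₃₁, h₃₂, hl, hp⟩
  · have hd := lineDist_descent
    rw [List.all_eq_true] at hd
    have hd := hd _ (mask_mem l)
    rw [List.all_eq_true] at hd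
    have hd := hd _ (mask_mem m)
    rw [Bool.or_eq_true, List.any_eq_true] at hd
    obtain ⟨k, hk, hd⟩ := hd.resolve_left fun e => h (Nat.eq_of_beq_eq_true e)
    obtain ⟨k, rfl⟩ := exists_mask_eq hk
    rw [Bool.and_eq_true, Bool.and_eq_true, not_beq_iff, not_beq_iff, Nat.beq_eq] at hd
    exact ⟨k, (H2D_adj_of_mask hd.1.2 hd.1.1).symm, hd.2⟩
  · simp only [lineDist, cond_eq_ite]
    split_ifs <;> norm_num

theorem hasOrder_H2D : HasOrder H2D 2 2 := by
  refine ⟨fun x => ?_, fun l => ?_⟩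
  · obtain ⟨l₁, l₂, l₃, h₁₂, h₃₁, h₃₂, hl, -⟩ := exists_pencil x
    exact Set.ncard_eq_three.2 ⟨l₁, l₂, l₃, h₁₂, h₃₁.symm, h₃₂.symm, Set.ext fun l => by simp [hl]⟩
  · obtain ⟨s, x, y, h, hs⟩ := l
    have hmem : ∀ z ∈ s, z ≠ 0 ∧ quadForm z = 0 := fun z hz =>
      isCayleyPoint_of_mem (l := ⟨s, x, y, h, hs⟩) hz
    have hx : x ∈ s := by simp [hs]
    have hy : y ∈ s := by simp [hs]
    have hxy : x + y ∈ s := by simp [hs]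
    refine Set.ncard_eq_three.2 ⟨⟨x, hmem x hx⟩, ⟨y, hmem y hy⟩, ⟨x + y, hmem _ hxy⟩, ?_, ?_, ?_,
      Set.ext fun z => ?_⟩
    · simpa using h.2.2.1
    · simpa using h.2.1
    · simpa using h.1
    · change z.1 ∈ s ↔ _
      simp [hs, Subtype.ext_iff]

/-! ### The embedding of `H(2,1)` -/

/-- The images of `pointVec` and `lineVec` give two disjoint planes on the quadric, and the form
takes the value `y ⬝ᵥ x` on `pointVec x + lineVec y`. -/
def pointVec (x : Fin 3 → ZMod 2) : Fin 7 → ZMod 2 := ![x 0, x 1, x 2, 0, 0, 0, 0]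

def lineVec (x : Fin 3 → ZMod 2) : Fin 7 → ZMod 2 := ![0, 0, 0, 0, x 0, x 1, x 2]

theorem pointVec_add_lineVec (x y : Fin 3 → ZMod 2) :
    pointVec x + lineVec y = ![x 0, x 1, x 2, 0, y 0, y 1, y 2] := by
  funext i
  fin_cases i <;> simp [pointVec, lineVec]

theorem add_inj_pointVec_lineVec {x x' y y' : Fin 3 → ZMod 2} :
    pointVec x + lineVec y = pointVec x' + lineVec y' ↔ x = x' ∧ y = y' := by
  refine ⟨fun h => ?_, fun h => by rw [h.1, h.2]⟩
  rw [pointVec_add_lineVec, pointVec_add_lineVec] at h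
  constructor <;> funext i <;> fin_cases i
  · exact congrFun h 0
  · exact congrFun h 1
  · exact congrFun h 2
  · exact congrFun h 4
  · exact congrFun h 5
  · exact congrFun h 6

theorem pointVec_zero : pointVec 0 = 0 := by
  funext i
  fin_cases i <;> rfl

theorem lineVec_zero : lineVec 0 = 0 := by
  funext i
  fin_cases i <;> rfl

theorem pointVec_inj {x y : Fin 3 → ZMod 2} : pointVec x = pointVec y ↔ x = y := by
  simpa [lineVec_zero] using add_inj_pointVec_lineVec (x := x) (x' := y) (y := 0) (y' := 0)

theorem lineVec_inj {x y : Fin 3 → ZMod 2} : lineVec x = lineVec y ↔ x = y := by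
  simpa [pointVec_zero] using add_inj_pointVec_lineVec (x := 0) (x' := 0) (y := x) (y' := y)

theorem pointVec_eq_lineVec_iff {x y : Fin 3 → ZMod 2} :
    pointVec x = lineVec y ↔ x = 0 ∧ y = 0 := by
  simpa [pointVec_zero, lineVec_zero, eq_comm (a := (0 : Fin 3 → ZMod 2))] using
    add_inj_pointVec_lineVec (x := x) (x' := 0) (y := 0) (y' := y)

theorem pointVec_eq_add_iff {x x' y : Fin 3 → ZMod 2} :
    pointVec x = pointVec x' + lineVec y ↔ x = x' ∧ y = 0 := by
  simpa [lineVec_zero, eq_comm (a := (0 : Fin 3 → ZMod 2))] using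
    add_inj_pointVec_lineVec (x := x) (x' := x') (y := 0) (y' := y)

theorem lineVec_eq_add_iff {x y y' : Fin 3 → ZMod 2} :
    lineVec y = pointVec x + lineVec y' ↔ y = y' ∧ x = 0 := by
  simpa [pointVec_zero, eq_comm (a := (0 : Fin 3 → ZMod 2)), and_comm] using
    add_inj_pointVec_lineVec (x := 0) (x' := x) (y := y) (y' := y')

theorem pointVec_isQuadric {x : Fin 3 → ZMod 2} (hx : x ≠ 0) :
    pointVec x ≠ 0 ∧ quadForm (pointVec x) = 0 := by
  refine ⟨fun h => hx (pointVec_inj.1 (h.trans pointVec_zero.symm)), ?_⟩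
  simp [quadForm, pointVec]

theorem lineVec_isQuadric {x : Fin 3 → ZMod 2} (hx : x ≠ 0) :
    lineVec x ≠ 0 ∧ quadForm (lineVec x) = 0 := by
  refine ⟨fun h => hx (lineVec_inj.1 (h.trans lineVec_zero.symm)), ?_⟩
  simp [quadForm, lineVec]

/-- All Grassmann coordinates in Tits' equations vanish: the index pairs on the left lie in `{0, 1,
2}` or in `{4, 5, 6}`, those on the right contain `3`. -/
theorem spanHexagonLine_pointVec_lineVec {x y : Fin 3 → ZMod 2} (hx : x ≠ 0) (hy : y ≠ 0)
    (hxy : y ⬝ᵥ x = 0) : SpanHexagonLine (pointVec x) (lineVec y) := by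
  refine ⟨(pointVec_isQuadric hx).1, (lineVec_isQuadric hy).1,
    fun h => hx (pointVec_eq_lineVec_iff.1 h).1, (pointVec_isQuadric hx).2,
    (lineVec_isQuadric hy).2, ?_, ?_⟩
  · rw [pointVec_add_lineVec]
    simp only [dotProduct, Fin.sum_univ_three] at hxy
    simpa [quadForm, mul_comm] using hxy
  · simp [grassmann, pointVec, lineVec]

def flagLine (e : FanoFlag) : CayleyLine :=
  ⟨{pointVec e.1.1.1, lineVec e.1.2.1, pointVec e.1.1.1 + lineVec e.1.2.1}, _, _,
    spanHexagonLine_pointVec_lineVec e.1.1.2 e.1.2.2 e.2, rfl⟩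

def vertexPoint : FanoVec ⊕ FanoVec → CayleyPoint
  | Sum.inl x => ⟨pointVec x.1, pointVec_isQuadric x.2⟩
  | Sum.inr y => ⟨lineVec y.1, lineVec_isQuadric y.2⟩

theorem mask_flagLine (e : FanoFlag) : mask (flagLine e) =
    lineMask (flagCodes.getD (flagIndex e) (1, 2)).1
      (16 * (flagCodes.getD (flagIndex e) (1, 2)).2) := by
  obtain ⟨h1, h2, -⟩ := flagCodes_bounds _ (flagIndex_lt e)
  have hp : ∀ a < 2 ^ 3, pointVec (bits 3 a) = bits 7 a := by decide +kernel
  -- The factor 16 moves the digits to the coordinates 4, 5, 6.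
  have hl : ∀ b < 2 ^ 3, lineVec (bits 3 b) = bits 7 (16 * b) := by decide +kernel
  refine (isMask_lineMask (by omega) (by omega) ?_).eq
  rw [← hp _ h1, ← hl _ h2, ← flag_fst, ← flag_snd]
  rfl

theorem pdist_flagLine (e f : FanoFlag) :
    pdist H21 e f = pdist H2D (flagLine e) (flagLine f) := by
  have hcomb : ∀ i < 21, ∀ j < 21, hdist i j = lineDist
      (lineMask (flagCodes.getD i (1, 2)).1 (16 * (flagCodes.getD i (1, 2)).2))
      (lineMask (flagCodes.getD j (1, 2)).1 (16 * (flagCodes.getD j (1, 2)).2)) := by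
    decide +kernel
  rw [pdist_H21, isNearHexagon_H2D_and_pdist.2, mask_flagLine, mask_flagLine,
    hcomb _ (flagIndex_lt e) _ (flagIndex_lt f)]

theorem isometricallyEmbeds_H21_H2D : IsometricallyEmbeds H21 H2D := by
  refine ⟨flagLine, vertexPoint, fun e f h => ?_, ?_, ?_, pdist_flagLine⟩
  -- An isometry is injective.
  · have h0 := pdist_flagLine e f
    rw [h, isNearHexagon_H2D_and_pdist.1.pdist_eq_zero_iff.2 rfl, pdist_H21] at h0
    have hz : ∀ i < 21, ∀ j < 21, hdist i j = 0 → i = j := by decide +kernel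
    exact flagIndex_injective (hz _ (flagIndex_lt e) _ (flagIndex_lt f) h0)
  · rintro (x | x) (y | y) h <;> have h := congrArg Subtype.val h
    · exact congrArg _ (Subtype.ext (pointVec_inj.1 h))
    · exact absurd (pointVec_eq_lineVec_iff.1 h).1 x.2
    · exact absurd (pointVec_eq_lineVec_iff.1 h.symm).1 y.2
    · exact congrArg _ (Subtype.ext (lineVec_inj.1 h))
  · rintro e (x | y)
    · change e.1.1 = x ↔ pointVec x.1 ∈ ({_, _, _} : Finset (Fin 7 → ZMod 2))
      rw [Finset.mem_insert, Finset.mem_insert, Finset.mem_singleton, pointVec_inj,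
        pointVec_eq_lineVec_iff, pointVec_eq_add_iff, Subtype.ext_iff]
      have := x.2
      have := e.1.2.2
      tauto
    · change e.1.2 = y ↔ lineVec y.1 ∈ ({_, _, _} : Finset (Fin 7 → ZMod 2))
      rw [Finset.mem_insert, Finset.mem_insert, Finset.mem_singleton, lineVec_inj,
        eq_comm (a := lineVec y.1) (b := pointVec _),
        pointVec_eq_lineVec_iff, lineVec_eq_add_iff, Subtype.ext_iff]
      have := y.2
      have := e.1.1.2
      tauto

end PointLine

open PointLine in
theorem theorem1p1 :
    (IsNearHexagon H2D ∧ HasOrder H2D 2 2 ∧ IsometricallyEmbeds H21 H2D) ∧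
    (∀ (P : Type*) (L : Type*) (I : P → L → Prop),
      IsNearHexagon I → HasOrder I 2 2 → IsometricallyEmbeds H21 I → Isomorphic I H2D) := by
  refine ⟨⟨isNearHexagon_H2D_and_pdist.1, hasOrder_H2D, isometricallyEmbeds_H21_H2D⟩,
    fun P L I hI hO hE => ?_⟩
  obtain ⟨φ, hφ⟩ := exists_isExtension hI hO hE
  obtain ⟨ψ, hψ⟩ := exists_isExtension isNearHexagon_H2D_and_pdist.1 hasOrder_H2D
    isometricallyEmbeds_H21_H2D
  exact hφ.isomorphic hψ
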